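/- **Setting.** Let $P_{\rm U},\sigma_{\rm D}^2,\ell_{\rm UR},\ell_{\rm RD},\ell_{\rm UD}>0$, $\kappa_{\rm R}\in(0,1]$, $\tau\ge 0$, Rician factors $K_{\rm UR},K_{\rm RD},K_{\rm UD}\ge0$, $N$ RIS elements, and finitely many aerial and ground interferers $X\in\{{\rm I}_1,\dots,{\rm I}_L,{\rm J}_1,\dots,{\rm J}_K\}$ with powers $P_X\ge0$, path losses $\ell_X>0$ and Rician factors $K_X\ge0$. All small-scale coefficients $h_{{\rm UR}_n},h_{{\rm R}_n{\rm D}},h_{\rm UD},h_{X{\rm D}}$ are independent and Rician: $h=(\sqrt{K}\,\check h+\tilde h)/\sqrt{K+1}$, $|\check h|=1$, $\tilde h\sim\mathcal{CN}(0,1)$, with the factor $K$ of the link (the same for all $n$). Put $\bar\gamma_{\rm cas}=P_{\rm U}\ell_{\rm UR}\ell_{\rm RD}\kappa_{\rm R}^2/\sigma_{\rm D}^2$, $\bar\gamma_{\rm dir}=P_{\rm U}\ell_{\rm UD}/\sigma_{\rm D}^2$, $\bar\gamma_X=P_X\ell_X/\sigma_{\rm D}^2$, $\lambda_{\rm UD}=(K_{\rm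 UD}+1)/\ell_{\rm UD}$, $\beta=\Pr(\ell_{\rm UD}|h_{\rm UD}|^2<\tau)$. The blockage process $(\phi_t)_{t\ge0}$ is a stationary Markov chain on $\{0,1\}$ with $p_{00}=p_{10}=\beta$, $p_{01}=p_{11}=1-\beta$ and steady state $\pi_0=p_{10}/(p_{01}+p_{10})$, $\pi_1=p_{01}/(p_{01}+p_{10})$, and $\phi_0=0$ (blocked) iff $\ell_{\rm UD}|h_{\rm UD}|^2<\tau$ (almost surely). Let $\gamma_{\rm cas}=\big(\sum_{n=1}^N|h_{{\rm UR}_n}||h_{{\rm R}_n{\rm D}}|\big)^2$, $\gamma_{\rm dir}=\phi_0|h_{\rm UD}|^2$, $\gamma=\gamma_{\rm dir}\bar\gamma_{\rm dir}/\bar\gamma_{\rm cas}$, $\gamma_{\rm a2g}=(\sqrt{\gamma_{\rm cas}}+\sqrt{\gamma})^2$, $W=1+\sum_X\bar\gamma_X|h_{X{\rm D}}|^2$; the A2G SINR is $\Gamma^\star_{\rm a2g}=(\sqrt{\bar\gamma_{\rm cas}\gamma_{\rm cas}}+\sqrt{\bar\gamma_{\rm dir}\gamma_{\rm dir}})^2/W=\bar\gamma_{\rm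 cas}\gamma_{\rm a2g}/W$. For a partition $p=(p_1,\dots,p_r)$ of $n$ whose distinct parts $p_{\langle i\rangle}$ have multiplicities $\nu_i$ and a sequence $f$, write $T_p(f)=n!\prod_j\frac1{p_j!}\prod_i\frac{f(p_{\langle i\rangle})^{\nu_i}}{\nu_i!}$. **Theorem.** (a) *Moments.* All moments below are finite. For every integer $j\ge0$, $\mathbb E[\gamma_{\rm cas}^{j/2}]=\sum_{p\vdash j}\frac{N!}{(N-r)!}T_p(\mu)$ (terms with $r>N$ being $0$), where $\mu_i=M(K_{\rm UR},\tfrac i2)M(K_{\rm RD},\tfrac i2)$, $M(K,k)=\Gamma(1+k)L_k(-K)/(1+K)^k$ and $L_k(x)={}_1F_1(-k;1;x)$ is the Laguerre function. For every integer $i\ge1$, $$\mathbb E[\gamma^{i/2}]=\frac{\pi_1}{1-\beta}\,\frac{Q_{i+1,0}\big(\sqrt{2K_{\rm UD}},\sqrt{2\lambda_{\rm UD}\tau}\big)}{(2\lambda_{\rm UD}\sigma_{\rm D}^2\bar\gamma_{\rm cas}/P_{\rm U})^{i/2}},$$ with the Nuttall function $Q_{m,n}(a,b)=\int_b^\infty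 t^me^{-(t^2+a^2)/2}I_n(at)\,dt$, and $\beta=1-Q_{1,0}(\sqrt{2K_{\rm UD}},\sqrt{2\lambda_{\rm UD}\tau})$. For every integer $k\ge0$, $\mu_{k}:=\mathbb E[\gamma_{\rm a2g}^k]=\sum_{i=0}^{2k}\binom{2k}{i}\mathbb E[\gamma_{\rm cas}^{k-i/2}]\,\mathbb E[\gamma^{i/2}]$. (b) *Interference.* With $c_X=\bar\gamma_X/(K_X+1)$, for $s\ge0$: $\mathbb E[e^{-sW}]=\Delta_{\rm D}^{(0)}(s):=e^{-s}\prod_X\frac{e^{-K_X+K_X/(1+c_Xs)}}{1+c_Xs}$, and for $n\ge0$ its $n$-th derivative is $\Delta_{\rm D}^{(n)}(s)=\Delta_{\rm D}^{(0)}(s)\sum_{p\vdash n}T_p(S(s))$, where $S_i(s)=\sum_X(i-1)!\frac{(-c_X)^i}{(1+c_Xs)^i}\big(1+\frac{iK_X}{1+c_Xs}\big)-C_i$, $C_1=1$, $C_i=0$ for $i\ge2$. (c) *CDF.* For every $x$, $\Pr(\Gamma^\star_{\rm a2g}\le x)=F_\nu(x)$ for $\nu$ the law of $\gamma_{\rm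 a2g}$, where $F_\nu$ denotes the CDF of $\bar\gamma_{\rm cas}Y/W$ with $Y\sim\nu$ independent of $W$. The law of $\gamma_{\rm a2g}$ is approximated by that of a sum of independent shadowed Rician variables (SISR) with the same first two moments, as follows. Let $I\ge1$ be an integer and $\psi>1$ a real number with $I\psi$ an integer and $I\le\lfloor\mu_1^2/(\mu_2-\mu_1^2)\rfloor$; put $\Omega=\frac{\sqrt\psi}{\sqrt{\psi-1}}\frac{\sqrt{\mu_1^2(I+1)-I\mu_2}}{I}$, $\sigma^2=\frac{\mu_1-I\Omega}{I}$, assumed positive, $\kappa=\frac{1-\sigma^2}{\sigma^2}$, $\xi=\frac{\Omega(\kappa+1)}{\psi}$, $\alpha_{\rm cas}=\frac{\xi+1}{\kappa+1}$, $\chi_{I,k}=\binom{I\psi-I}{k}\frac1{(\xi+1)^k}\big(\frac{\xi}{\xi+1}\big)^{I\psi-I-k}$. Let $\nu$ be the law of $Y=\sum_{i=1}^I|Z_i+\zeta_iu_i|^2$, with $Z_i\sim\mathcal{CN}(0,\sigma^2)$, $\zeta_i$ Nakagami with shape $\psi$ and $\mathbb E\zeta_i^2=\Omega$ ($\zeta_i=0$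 if $\Omega=0$), all independent, and constants $|u_i|=1$. Then $\mathbb E[Y]=\mathbb E[\gamma_{\rm a2g}]$, $\mathbb E[Y^2]=\mathbb E[\gamma_{\rm a2g}^2]$, and the CDF of the A2G SINR under this approximation is, for all $x>0$, $$F_\nu(x)=1-\sum_{k=0}^{I\psi-I}\chi_{I,k}\sum_{n=0}^{I\psi-k-1}\frac{(-s_0)^n\,\Delta_{\rm D}^{(n)}(s_0)}{n!},\qquad s_0=\frac{x}{\alpha_{\rm cas}\bar\gamma_{\rm cas}}.$$ -/

import Mathlib

open MeasureTheory ProbabilityTheory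
open scoped Nat

noncomputable section

namespace A2G

/-! ### Special functions -/

/-- Modified Bessel function of the first kind, of integer order `n`. -/
def besselI (n : ℕ) (x : ℝ) : ℝ :=
  ∑' k : ℕ, (x / 2) ^ (2 * k + n) / ((k ! : ℝ) * ((k + n)! : ℝ))

/-- Nuttall `Q`-function `Q_{m,n}(a,b) = ∫_b^∞ t^m e^{-(t²+a²)/2} I_n(a t) dt`.
`Q_{1,0}` is the first order Marcum `Q`-function. -/
def nuttallQ (m n : ℕ) (a b : ℝ) : ℝ :=
  ∫ t in Set.Ioi b, t ^ m * Real.exp (-(t ^ 2 + a ^ 2) / 2) * besselI n (a * t)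

/-- Laguerre function of real order `ν`, `L_ν(x) = ₁F₁(-ν; 1; x)`; the Laguerre polynomial
for `ν ∈ ℕ`. -/
def laguerreFn (ν x : ℝ) : ℝ :=
  ∑' n : ℕ, (ascPochhammer ℝ n).eval (-ν) / ((n ! : ℝ) ^ 2) * x ^ n

/-- The term of a partition `p = (p₁, …, p_r)` of `n` in the multinomial and Faà di Bruno
formulas: `n! ∏_j 1/p_j! ∏_i f(p_⟨i⟩)^{ν_i} / ν_i!`, where `p_⟨i⟩` are the distinct parts
and `ν_i` their multiplicities. -/
def partitionTerm {n : ℕ} (p : n.Partition) (f : ℕ → ℝ) : ℝ :=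
  (n ! : ℝ) * (p.parts.map fun j => ((j ! : ℝ))⁻¹).prod *
    ∏ j ∈ p.parts.toFinset, f j ^ p.parts.count j / ((p.parts.count j)! : ℝ)

/-! ### Distributions -/

/-- Circularly symmetric complex Gaussian law `CN(0, v)`. -/
def complexGaussian (v : ℝ) : Measure ℂ :=
  ((gaussianReal 0 (v / 2).toNNReal).prod (gaussianReal 0 (v / 2).toNNReal)).map
    fun q => (⟨q.1, q.2⟩ : ℂ)

/-- Law of the Rician small-scale fading coefficient `(√K u + z) / √(K+1)`,
`z ~ CN(0,1)`, with line-of-sight component `u`. -/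
def ricianFading (K : ℝ) (u : ℂ) : Measure ℂ :=
  (complexGaussian 1).map fun z => ((√K : ℝ) * u + z) / ((√(K + 1) : ℝ) : ℂ)

/-- Nakagami law with shape `ψ` and spread `Om`: the law of `√(Om G / ψ)` for
`G ~ Gamma(ψ, 1)` (the point mass at `0` if `Om = 0`). -/
def nakagami (ψ Om : ℝ) : Measure ℝ :=
  (gammaMeasure ψ 1).map fun g => √(Om * g / ψ)

/-- Shadowed Rician power law: the law of `|Z + ξ u|²` with independent `Z ~ CN(0, s2)` and
`ξ` Nakagami with shape `ψ` and spread `Om`. -/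
def shadowedRician (ψ Om s2 : ℝ) (u : ℂ) : Measure ℝ :=
  ((complexGaussian s2).prod (nakagami ψ Om)).map fun q => ‖q.1 + (q.2 : ℂ) * u‖ ^ 2

/-- Law of a sum of `I` independent shadowed Rician powers (SISR law). -/
def sisr (I : ℕ) (ψ Om s2 : ℝ) (u : Fin I → ℂ) : Measure ℝ :=
  (Measure.pi fun i => shadowedRician ψ Om s2 (u i)).map fun x => ∑ i, x i

/-! ### Parameters of the SISR law with prescribed first two moments `μ₁`, `μ₂` -/

def sisrOmega (I : ℕ) (ψ μ₁ μ₂ : ℝ) : ℝ :=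
  √ψ / √(ψ - 1) * (√(μ₁ ^ 2 * (I + 1) - I * μ₂) / I)

def sisrSigma2 (I : ℕ) (ψ μ₁ μ₂ : ℝ) : ℝ :=
  (μ₁ - I * sisrOmega I ψ μ₁ μ₂) / I

def sisrKappa (I : ℕ) (ψ μ₁ μ₂ : ℝ) : ℝ :=
  (1 - sisrSigma2 I ψ μ₁ μ₂) / sisrSigma2 I ψ μ₁ μ₂

/-- `ξ = κ ω / ψ` with `κ ω = Ω (κ + 1)`. -/
def sisrXi (I : ℕ) (ψ μ₁ μ₂ : ℝ) : ℝ :=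
  sisrOmega I ψ μ₁ μ₂ * (sisrKappa I ψ μ₁ μ₂ + 1) / ψ

def sisrAlpha (I : ℕ) (ψ μ₁ μ₂ : ℝ) : ℝ :=
  (sisrXi I ψ μ₁ μ₂ + 1) / (sisrKappa I ψ μ₁ μ₂ + 1)

/-- The weight `χ_{I,k}`; here `m = I ψ`. -/
def sisrChi (I m : ℕ) (ψ μ₁ μ₂ : ℝ) (k : ℕ) : ℝ :=
  ((m - I).choose k : ℝ) * (1 / (sisrXi I ψ μ₁ μ₂ + 1) ^ k) *
    (sisrXi I ψ μ₁ μ₂ / (sisrXi I ψ μ₁ μ₂ + 1)) ^ (m - I - k)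

/-! ### The system -/

/-- The links that end at the receiver or pass through the RIS: UAV to RIS element, RIS element
to receiver, UAV to receiver, aerial and ground interferer to receiver. -/
inductive Link (N L K : ℕ)
  | ur (n : Fin N)
  | rd (n : Fin N)
  | ud
  | aerial (l : Fin L)
  | ground (k : Fin K)

/-- Deterministic parameters of a system with `N` RIS elements, `L` aerial and `K` ground
interferers. -/
structure System (N L K : ℕ) where
  /-- transmit power of the UAV -/
  PU : ℝ
  /-- noise variance at the receiver -/
  noise : ℝ
  /-- amplitude reflection coefficient of the RIS elements -/
  refl : ℝ
  /-- blockage threshold for the power gain of the direct link -/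
  τ : ℝ
  /-- path losses -/
  lossUR : ℝ
  lossRD : ℝ
  lossUD : ℝ
  lossI : Fin L → ℝ
  lossJ : Fin K → ℝ
  /-- Rician `K`-factors -/
  riceUR : ℝ
  riceRD : ℝ
  riceUD : ℝ
  riceI : Fin L → ℝ
  riceJ : Fin K → ℝ
  /-- transmit powers of the interferers -/
  PI : Fin L → ℝ
  PJ : Fin K → ℝ
  /-- line-of-sight components -/
  los : Link N L K → ℂ
  PU_pos : 0 < PU
  noise_pos : 0 < noise
  refl_pos : 0 < refl
  refl_le_one : refl ≤ 1
  τ_nonneg : 0 ≤ τ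
  lossUR_pos : 0 < lossUR
  lossRD_pos : 0 < lossRD
  lossUD_pos : 0 < lossUD
  lossI_pos : ∀ l, 0 < lossI l
  lossJ_pos : ∀ k, 0 < lossJ k
  riceUR_nonneg : 0 ≤ riceUR
  riceRD_nonneg : 0 ≤ riceRD
  riceUD_nonneg : 0 ≤ riceUD
  riceI_nonneg : ∀ l, 0 ≤ riceI l
  riceJ_nonneg : ∀ k, 0 ≤ riceJ k
  PI_nonneg : ∀ l, 0 ≤ PI l
  PJ_nonneg : ∀ k, 0 ≤ PJ k
  norm_los : ∀ e, ‖los e‖ = 1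

namespace System

variable {N L K : ℕ} (S : System N L K)

/-- The Rician factor of a link. -/
def rice : Link N L K → ℝ
  | .ur _ => S.riceUR
  | .rd _ => S.riceRD
  | .ud => S.riceUD
  | .aerial l => S.riceI l
  | .ground k => S.riceJ k

/-- Average SNR `γ̄_cas` of the cascaded link. -/
def snrCas : ℝ := S.PU * S.lossUR * S.lossRD * |S.refl| ^ 2 / S.noise

/-- Average SNR `γ̄_dir` of the direct link. -/
def snrDir : ℝ := S.PU * S.lossUD / S.noise

/-- Average interference-to-noise ratios `γ̄_{I_l D}`, `γ̄_{J_k D}`. -/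
def inrI (l : Fin L) : ℝ := S.PI l * S.lossI l / S.noise

def inrJ (k : Fin K) : ℝ := S.PJ k * S.lossJ k / S.noise

/-- `λ_UD = (K_UD + 1) / ℓ_UD`. -/
def lamUD : ℝ := (S.riceUD + 1) / S.lossUD

/-- Blockage probability `β = Pr(|g_UD|² < τ)`, where `|g_UD|² = ℓ_UD |h_UD|²`. -/
def blockProb : ℝ :=
  (ricianFading S.riceUD (S.los .ud)).real {z | S.lossUD * ‖z‖ ^ 2 < S.τ}

/-- Transition matrix of the blockage chain: state `0` (blocked) is entered with probability `β`,
state `1` (unblocked) with probability `1 - β`, from either state. -/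
def transition : Matrix (Fin 2) (Fin 2) ℝ :=
  !![S.blockProb, 1 - S.blockProb; S.blockProb, 1 - S.blockProb]

/-- Steady-state probabilities `(π₀, π₁)` of the blockage chain. -/
def steady : Fin 2 → ℝ :=
  ![S.transition 1 0 / (S.transition 0 1 + S.transition 1 0),
    S.transition 0 1 / (S.transition 0 1 + S.transition 1 0)]

/-! Closed-form moments -/

/-- `μ_{k,|h|²} = Γ(1+k) L_k(-K) / (1+K)^k` for a Rician coefficient with factor `K`. -/
def momRice (K k : ℝ) : ℝ := Real.Gamma (1 + k) * laguerreFn k (-K) / (1 + K) ^ k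

/-- Closed form of `μ_{j/2, γ_cas}`; the sum over the partitions of `j` into `r` parts, for all
`r`, and `N.descFactorial r = N! / (N - r)!` (zero for `r > N`). -/
def momCas (j : ℕ) : ℝ :=
  ∑ p : j.Partition, (N.descFactorial p.parts.card : ℝ) *
    partitionTerm p fun i => momRice S.riceUR ((i : ℝ) / 2) * momRice S.riceRD ((i : ℝ) / 2)

/-- Closed form of `μ_{i/2, γ}`, `γ = γ_dir γ̄_dir / γ̄_cas`, by the Nuttall `Q`-function. -/
def momDir (i : ℕ) : ℝ :=
  if i = 0 then 1 else
    S.steady 1 / (1 - S.blockProb) *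
      (nuttallQ (i + 1) 0 √(2 * S.riceUD) √(2 * S.lamUD * S.τ) /
        (2 * S.lamUD * S.noise * S.snrCas / S.PU) ^ ((i : ℝ) / 2))

/-- Closed form of `μ_{k, γ_a2g}`. -/
def momA2G (k : ℕ) : ℝ :=
  ∑ i ∈ Finset.range (2 * k + 1), ((2 * k).choose i : ℝ) * S.momCas (2 * k - i) * S.momDir i

/-! Interference -/

/-- Laplace transform at `s` of `c̄ |h|²`, where `h` is a Rician coefficient with factor `K`,
`E|h|² = 1`, and `c = c̄ / (K + 1)`. -/
def riceLaplace (K c s : ℝ) : ℝ := Real.exp (-K + K / (1 + c * s)) / (1 + c * s)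

/-- The function `Δ_D^{(0)}`. -/
def delta0 (s : ℝ) : ℝ :=
  Real.exp (-s) * (∏ l, riceLaplace (S.riceI l) (S.inrI l / (S.riceI l + 1)) s) *
    ∏ k, riceLaplace (S.riceJ k) (S.inrJ k / (S.riceJ k + 1)) s

/-- `δ^{(n)}(s) = (n-1)! (-c)^n / (1 + c s)^n (1 + n K / (1 + c s))`. -/
def smallDelta (K c : ℝ) (n : ℕ) (s : ℝ) : ℝ :=
  ((n - 1)! : ℝ) * ((-c) ^ n / (1 + c * s) ^ n) * (1 + n * K / (1 + c * s))

/-- `S_i(s)`. -/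
def logDeriv (s : ℝ) (i : ℕ) : ℝ :=
  (∑ l, smallDelta (S.riceI l) (S.inrI l / (S.riceI l + 1)) i s) +
    (∑ k, smallDelta (S.riceJ k) (S.inrJ k / (S.riceJ k + 1)) i s) - if i = 1 then 1 else 0

/-- Closed form of `Δ_D^{(n)}`, the `n`-th derivative of `Δ_D^{(0)}`. -/
def delta (n : ℕ) (s : ℝ) : ℝ :=
  S.delta0 s * ∑ p : n.Partition, partitionTerm p (S.logDeriv s)

end System

/-- The random channels of the system: independent Rician coefficients `h`, and a blockage process
`state` that is a stationary Markov chain with the given transition matrix and whose initial state is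
`0` (blocked) exactly if the power gain of the direct link is below the threshold. -/
structure Channels {N L K : ℕ} (S : System N L K) {Ω : Type*} [MeasurableSpace Ω]
    (P : Measure Ω) where
  h : Link N L K → Ω → ℂ
  state : ℕ → Ω → Fin 2
  measurable_h : ∀ e, Measurable (h e)
  law_h : ∀ e, HasLaw (h e) (ricianFading (S.rice e) (S.los e)) P
  indep_h : iIndepFun h P
  measurable_state : ∀ t, Measurable (state t)
  markov_state : ∀ (T : ℕ) (a : Fin (T + 1) → Fin 2),
    P.real {ω | ∀ t : Fin (T + 1), state t ω = a t} =
      S.steady (a 0) * ∏ t : Fin T, S.transition (a t.castSucc) (a t.succ)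
  blocked_iff : ∀ᵐ ω ∂P, state 0 ω = 0 ↔ S.lossUD * ‖h .ud ω‖ ^ 2 < S.τ

namespace Channels

variable {N L K : ℕ} {S : System N L K} {Ω : Type*} [MeasurableSpace Ω] {P : Measure Ω}
  (C : Channels S P)

/-- `γ_cas = (∑ |h_{UR_n}| |h_{R_n D}|)²`. -/
def gCas (ω : Ω) : ℝ := (∑ n, ‖C.h (.ur n) ω‖ * ‖C.h (.rd n) ω‖) ^ 2

/-- `γ_dir = φ₀ |h_UD|²`. -/
def gDir (ω : Ω) : ℝ := ((C.state 0 ω : ℕ) : ℝ) * ‖C.h .ud ω‖ ^ 2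

/-- `γ = γ_dir γ̄_dir / γ̄_cas`. -/
def gDirN (ω : Ω) : ℝ := C.gDir ω * S.snrDir / S.snrCas

/-- Normalized SNR `γ_a2g = |√γ_cas + √γ|²`. -/
def gA2G (ω : Ω) : ℝ := |√(C.gCas ω) + √(C.gDirN ω)| ^ 2

/-- Aggregated interference-to-noise ratio `γ_ID + γ_JD` at the receiver. -/
def inr (ω : Ω) : ℝ :=
  (∑ l, S.inrI l * ‖C.h (.aerial l) ω‖ ^ 2) + ∑ k, S.inrJ k * ‖C.h (.ground k) ω‖ ^ 2

/-- The SINR `Γ*_a2g` at the receiver under the optimal phase shifts. -/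
def sinr (ω : Ω) : ℝ :=
  |√(S.snrCas * C.gCas ω) + √(S.snrDir * C.gDir ω)| ^ 2 / (C.inr ω + 1)

/-- CDF at `x` of `γ̄_cas Y / (γ_ID + γ_JD + 1)`, where `Y` has law `ν` and is independent of the
interference: the SINR distribution for a normalized SNR with law `ν`. -/
def sinrCDF (ν : Measure ℝ) (x : ℝ) : ℝ :=
  (ν.prod P).real {q | S.snrCas * q.1 / (C.inr q.2 + 1) ≤ x}

end Channels

end A2G

end

/-! Three mechanisms carry the proof.

Rician powers. In polar coordinates the angular integral of a shifted complex Gaussian density is a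
Bessel function `I_0`, so the modulus has an explicit density
(`lintegral_norm_add_complexGaussian`). Truncated moments of that density are Nuttall functions.
Expanding `I_0` in its power series shows that the squared modulus is a Poisson mixture of Gamma
laws with shapes n + 1 (`lintegral_sq_norm_add_complexGaussian`). Averaging Gamma moments over the
Poisson weights gives a Kummer series, which Kummer's transformation turns into the Laguerre
function; averaging Gamma Laplace transforms gives `riceLaplace`.

Partition sums. Marking one part of a partition of n + 1 and removing it gives a recursion
(`sum_partitionTerm_succ`). Powers of an exponential generating function satisfy it, because
(A^(N+1))' = (N+1) A' A^N; this yields the moments of a sum of N independent products. The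
derivatives of a function F with F' = G F satisfy it as well, by Leibniz's rule; this yields the
derivatives of the interference transform, whose logarithm is a sum of elementary terms.

The SISR law. Conditioning on the Nakagami amplitude gives its Laplace transform (1 + σ²t)^(m-I) /
(1 + αt)^m with m = Iψ and α = σ² + Ω/ψ. Since 1 + σ²t is a convex combination of 1 + αt and 1, the
binomial theorem expresses this as a finite mixture of Erlang transforms, and uniqueness of Laplace
transforms identifies the law (`sisr_eq_erlangMixture`). The first two moments follow from those of
binomial weights, and Ω and σ² are the solution of the two matching equations. An Erlang tail is a
finite sum of e^(-y) y^n / n!. At y = s₀W its mean over the interference consists of the numbers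
E[W^n e^(-s₀W)] = (-1)^n Δ^(n)(s₀), which is the stated CDF.

The links are tied together by independence: the initial blockage state is almost surely a function
of the direct coefficient, so the cascaded gain, the direct gain and the interference depend on
disjoint sets of independent coefficients. -/

namespace A2G

/-! ### Sums over partitions -/

/-- The weight of a multiset of parts in `partitionTerm`, without the factor `n!`. -/
noncomputable def partsWeight (f : ℕ → ℝ) (s : Multiset ℕ) : ℝ :=
  (s.map fun j => ((j ! : ℝ))⁻¹).prod *
    ∏ j ∈ s.toFinset, f j ^ s.count j / ((s.count j)! : ℝ)

lemma partitionTerm_eq {n : ℕ} (p : n.Partition) (f : ℕ → ℝ) :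
    partitionTerm p f = n ! * partsWeight f p.parts := by
  rw [partitionTerm, partsWeight, mul_assoc]

/-- Only the multiplicity of j changes, from ν to ν + 1. The factor ν + 1 on the left cancels the
new factor of (ν + 1)!, leaving one extra f j / j!. -/
lemma partsWeight_cons (f : ℕ → ℝ) (s : Multiset ℕ) (j : ℕ) :
    ((j ::ₘ s).count j : ℝ) * partsWeight f (j ::ₘ s) =
      ((j ! : ℝ))⁻¹ * f j * partsWeight f s := by
  have h1 : ∏ i ∈ s.toFinset, f i ^ s.count i / ((s.count i)! : ℝ) =
      ∏ i ∈ insert j s.toFinset, f i ^ s.count i / ((s.count i)! : ℝ) := by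
    refine Finset.prod_subset (Finset.subset_insert _ _) fun i _ hi => ?_
    rw [Multiset.mem_toFinset] at hi
    simp [Multiset.count_eq_zero.2 hi]
  rw [partsWeight, partsWeight, h1, Multiset.toFinset_cons, Multiset.map_cons, Multiset.prod_cons,
    ← Finset.mul_prod_erase _ _ (Finset.mem_insert_self j _),
    ← Finset.mul_prod_erase _ (fun i => f i ^ s.count i / ((s.count i)! : ℝ))
      (Finset.mem_insert_self j _)]
  have h2 : ∀ i ∈ (insert j s.toFinset).erase j,
      f i ^ (j ::ₘ s).count i / (((j ::ₘ s).count i)! : ℝ) =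
        f i ^ s.count i / ((s.count i)! : ℝ) := by
    intro i hi
    rw [Multiset.count_cons_of_ne (Finset.ne_of_mem_erase hi)]
  rw [Finset.prod_congr rfl h2, Multiset.count_cons_self, Nat.factorial_succ, pow_succ]
  have h3 : ((s.count j)! : ℝ) ≠ 0 := by positivity
  have h4 : ((s.count j : ℝ) + 1) ≠ 0 := by positivity
  push_cast
  field_simp

/-- The multisets of parts of the partitions of `n`. -/
def partsFinset (n : ℕ) : Finset (Multiset ℕ) :=
  (Finset.univ : Finset n.Partition).image Nat.Partition.parts

lemma mem_partsFinset {n : ℕ} {s : Multiset ℕ} :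
    s ∈ partsFinset n ↔ (∀ i ∈ s, 0 < i) ∧ s.sum = n := by
  simp only [partsFinset, Finset.mem_image, Finset.mem_univ, true_and]
  constructor
  · rintro ⟨p, rfl⟩
    exact ⟨fun i hi => p.parts_pos hi, p.parts_sum⟩
  · rintro ⟨h1, h2⟩
    exact ⟨⟨s, fun {i} hi => h1 i hi, h2⟩, rfl⟩

/-- Bare multisets do not carry the size n in their type, so parts can be added and erased without
transport between partition types. -/
lemma sum_partition_eq (n : ℕ) (F : Multiset ℕ → ℝ) :
    ∑ p : n.Partition, F p.parts = ∑ s ∈ partsFinset n, F s := by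
  rw [partsFinset, Finset.sum_image]
  intro p _ q _ h
  exact Nat.Partition.ext h

/-- Recursion for sums over partitions, by removal of one part. -/
theorem sum_partitionTerm_succ (g : ℕ → ℝ) (f : ℕ → ℝ) (n : ℕ) :
    ∑ p : (n + 1).Partition, g p.parts.card * partitionTerm p f =
      ∑ k ∈ Finset.range (n + 1), (n.choose k : ℝ) * f (k + 1) *
        ∑ q : (n - k).Partition, g (q.parts.card + 1) * partitionTerm q f := by
  simp_rw [partitionTerm_eq]
  rw [sum_partition_eq (n + 1) fun s => g s.card * ((n + 1)! * partsWeight f s)]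
  have hr : ∀ k, ∑ q : (n - k).Partition,
      g (q.parts.card + 1) * ((n - k)! * partsWeight f q.parts) =
      ∑ s ∈ partsFinset (n - k), g (s.card + 1) * ((n - k)! * partsWeight f s) := fun k =>
    sum_partition_eq (n - k) fun s => g (s.card + 1) * ((n - k)! * partsWeight f s)
  simp_rw [hr]
  -- Double counting: n + 1 is the sum of j times the multiplicity of j over the distinct parts j.
  -- Splitting (n + 1)! = (n + 1) n! therefore marks one distinct part.
  have hl : ∀ s ∈ partsFinset (n + 1), g s.card * ((n + 1)! * partsWeight f s) =
      ∑ j ∈ s.toFinset, (j * s.count j : ℝ) * (g s.card * (n ! * partsWeight f s)) := by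
    intro s hs
    rw [← Finset.sum_mul]
    have h : (∑ j ∈ s.toFinset, (j * s.count j : ℝ)) = (n + 1 : ℕ) := by
      rw [← (mem_partsFinset.1 hs).2, Finset.sum_multiset_count]
      push_cast
      exact Finset.sum_congr rfl fun j _ => by
        rw [nsmul_eq_mul, Nat.cast_mul, mul_comm, Nat.cast_id]
    rw [h, Nat.factorial_succ]
    push_cast
    ring
  rw [Finset.sum_congr rfl hl]
  simp_rw [Finset.mul_sum]
  rw [Finset.sum_sigma', Finset.sum_sigma']
  -- A multiset with a marked part j corresponds to k = j - 1 and the multiset with one copy of j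
  -- erased; positivity of the parts makes the truncated subtraction invertible.
  refine Finset.sum_bij' (fun x _ => ⟨x.2 - 1, x.1.erase x.2⟩)
    (fun y _ => ⟨(y.1 + 1) ::ₘ y.2, y.1 + 1⟩) ?_ ?_ ?_ ?_ ?_
  · rintro ⟨s, j⟩ h
    simp only [Finset.mem_sigma, mem_partsFinset, Multiset.mem_toFinset, Finset.mem_range] at h ⊢
    obtain ⟨⟨h1, h2⟩, h3⟩ := h
    have h4 := Multiset.sum_erase h3
    have h5 := h1 j h3
    refine ⟨by omega, fun i hi => h1 i (Multiset.mem_of_mem_erase hi), by omega⟩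
  · rintro ⟨k, s⟩ h
    simp only [Finset.mem_sigma, mem_partsFinset, Multiset.mem_toFinset, Finset.mem_range] at h ⊢
    obtain ⟨h3, h1, h2⟩ := h
    refine ⟨⟨?_, ?_⟩, Multiset.mem_cons_self _ _⟩
    · intro i hi
      rcases Multiset.mem_cons.1 hi with rfl | hi
      · omega
      · exact h1 i hi
    · rw [Multiset.sum_cons]; omega
  · rintro ⟨s, j⟩ h
    simp only [Finset.mem_sigma, mem_partsFinset, Multiset.mem_toFinset] at h
    have h5 := h.1.1 j h.2
    have h6 : j - 1 + 1 = j := by omega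
    simp only [h6, Multiset.cons_erase h.2]
  · rintro ⟨k, s⟩ h
    simp
  · rintro ⟨s, j⟩ h
    simp only [Finset.mem_sigma, mem_partsFinset, Multiset.mem_toFinset] at h
    obtain ⟨⟨h1, h2⟩, h3⟩ := h
    obtain ⟨k, rfl⟩ : ∃ k, j = k + 1 := ⟨j - 1, by have := h1 j h3; omega⟩
    obtain ⟨t, rfl⟩ := Multiset.exists_cons_of_mem h3
    have hk : k ≤ n := by rw [Multiset.sum_cons] at h2; omega
    simp only [Nat.add_sub_cancel, Multiset.erase_cons_head, Multiset.card_cons]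
    have h := partsWeight_cons f t (k + 1)
    have hc : ((n.choose k : ℕ) : ℝ) = n ! / (k ! * (n - k)!) := by
      rw [Nat.cast_choose ℝ hk]
    rw [hc]
    calc _ = ((k + 1 : ℕ) : ℝ) * g (t.card + 1) * n ! *
          (((((k + 1) ::ₘ t).count (k + 1) : ℕ) : ℝ) * partsWeight f ((k + 1) ::ₘ t)) := by ring
      _ = _ := by
        rw [h, Nat.factorial_succ]
        have h7 : (k ! : ℝ) ≠ 0 := by positivity
        have h8 : ((n - k)! : ℝ) ≠ 0 := by positivity
        have h9 : ((k + 1 : ℕ) : ℝ) ≠ 0 := by positivity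
        rw [Nat.cast_mul]
        field_simp

lemma sum_partitionTerm_zero (g : ℕ → ℝ) (f : ℕ → ℝ) :
    ∑ p : (0 : ℕ).Partition, g p.parts.card * partitionTerm p f = g 0 := by
  rw [Fintype.sum_unique]
  simp [partitionTerm, Nat.Partition.partition_zero_parts]

/-- Partition sums are unique solutions of the recursion of a function equal to its logarithmic
derivative times itself. -/
theorem sum_partitionTerm_unique (f B : ℕ → ℝ) (b : ℝ) (h0 : B 0 = b)
    (hs : ∀ n, B (n + 1) = ∑ k ∈ Finset.range (n + 1), (n.choose k : ℝ) * f (k + 1) * B (n - k))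
    (n : ℕ) : B n = b * ∑ p : n.Partition, partitionTerm p f := by
  induction n using Nat.strong_induction_on with
  | _ n ih =>
    cases n with
    | zero => simpa [h0] using (congrArg (b * ·) (sum_partitionTerm_zero (fun _ => 1) f)).symm
    | succ n =>
      have h := sum_partitionTerm_succ (fun _ => 1) f n
      simp only [one_mul] at h
      rw [h, hs, Finset.mul_sum]
      refine Finset.sum_congr rfl fun k _ => ?_
      rw [ih (n - k) (by omega)]
      ring

/-! ### Powers of exponential generating functions -/

/-- The exponential generating function of `f`, with constant coefficient `1`. -/
noncomputable def egf (f : ℕ → ℝ) : PowerSeries ℝ :=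
  PowerSeries.mk fun n => if n = 0 then 1 else f n / n !

/-- Induction on N. Coefficients of (A^(N+1))' = (N+1) A' A^N reproduce the removal of one part, and
the descending factorial of N + 1 at r + 1 is N + 1 times that of N at r. The constant coefficient
of A is 1 whatever `f 0` is, so indices that contribute no part carry weight one. -/
theorem coeff_egf_pow (f : ℕ → ℝ) (N n : ℕ) :
    (n ! : ℝ) * PowerSeries.coeff n (egf f ^ N) =
      ∑ p : n.Partition, (N.descFactorial p.parts.card : ℝ) * partitionTerm p f := by
  induction N generalizing n with
  | zero =>
    cases n with
    | zero =>
      have := sum_partitionTerm_zero (fun r => ((0 : ℕ).descFactorial r : ℝ)) f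
      rw [this]; simp
    | succ n =>
      rw [Finset.sum_eq_zero]
      · simp [PowerSeries.coeff_one]
      · intro p _
        have : p.parts.card ≠ 0 := by
          intro h
          have h1 := p.parts_sum
          rw [Multiset.card_eq_zero.1 h] at h1
          simp at h1
        obtain ⟨r, hr⟩ := Nat.exists_eq_succ_of_ne_zero this
        simp [hr]
  | succ N ih =>
    cases n with
    | zero =>
      have := sum_partitionTerm_zero (fun r => ((N + 1).descFactorial r : ℝ)) f
      rw [this]; simp [egf]
    | succ n =>
      have hd := congrArg (PowerSeries.coeff n)
        ((PowerSeries.derivative ℝ).leibniz_pow (egf f) (N + 1))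
      rw [PowerSeries.coeff_derivative, Nat.add_sub_cancel,
        nsmul_eq_mul, smul_eq_mul, mul_comm (egf f ^ N)] at hd
      have h := sum_partitionTerm_succ (fun r => ((N + 1).descFactorial r : ℝ)) f n
      simp only [Nat.succ_descFactorial_succ] at h
      rw [h, Nat.factorial_succ]
      have hd' : PowerSeries.coeff (n + 1) (egf f ^ (N + 1)) * (n + 1) =
          (N + 1 : ℝ) * PowerSeries.coeff n (PowerSeries.derivative ℝ (egf f) * egf f ^ N) := by
        rw [hd, ← map_natCast (PowerSeries.C (R := ℝ)), PowerSeries.coeff_C_mul]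
        push_cast
        ring
      push_cast
      calc _ = (n ! : ℝ) * (PowerSeries.coeff (n + 1) (egf f ^ (N + 1)) * (n + 1)) := by ring
        _ = _ := by
          rw [hd', PowerSeries.coeff_mul, Finset.Nat.sum_antidiagonal_eq_sum_range_succ_mk,
            Finset.mul_sum, Finset.mul_sum]
          refine Finset.sum_congr rfl fun k hk => ?_
          have hk' : k ≤ n := by rw [Finset.mem_range] at hk; omega
          simp only [mul_assoc]
          rw [← Finset.mul_sum, ← ih (n - k), PowerSeries.coeff_derivative,
            Nat.cast_choose ℝ hk']
          simp only [egf, PowerSeries.coeff_mk, Nat.add_eq_zero_iff, one_ne_zero, and_false,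
            if_false]
          have h7 : (k ! : ℝ) ≠ 0 := by positivity
          have h8 : ((n - k)! : ℝ) ≠ 0 := by positivity
          rw [Nat.factorial_succ]
          push_cast
          field_simp

/-! ### Derivatives of the Laplace transform of the interference -/

open Filter Topology in
/-- Faà di Bruno's formula for a function with logarithmic derivatives `G · 1, G · 2, …`. -/
theorem iteratedDeriv_eq_sum_partitionTerm {F : ℝ → ℝ} {G : ℝ → ℕ → ℝ} {U : Set ℝ}
    (hU : IsOpen U) (hF : ∀ s ∈ U, HasDerivAt F (F s * G s 1) s)
    (hG : ∀ s ∈ U, ∀ i, 1 ≤ i → HasDerivAt (fun s => G s i) (G s (i + 1)) s)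
    (hFc : ∀ s ∈ U, ∀ n : ℕ, ContDiffAt ℝ n F s)
    (hGc : ∀ s ∈ U, ∀ n : ℕ, ContDiffAt ℝ n (fun s => G s 1) s) (n : ℕ) {s : ℝ} (hs : s ∈ U) :
    iteratedDeriv n F s = F s * ∑ p : n.Partition, partitionTerm p (G s) := by
  have hGi : ∀ k : ℕ, ∀ s ∈ U, iteratedDeriv k (fun s => G s 1) s = G s (k + 1) := by
    intro k
    induction k with
    | zero => intro s _; simp
    | succ k ih =>
      intro s hs
      rw [iteratedDeriv_succ]
      have : iteratedDeriv k (fun s => G s 1) =ᶠ[𝓝 s] fun s => G s (k + 1) :=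
        eventually_of_mem (hU.mem_nhds hs) ih
      rw [this.deriv_eq]
      exact (hG s hs (k + 1) (by omega)).deriv
  refine sum_partitionTerm_unique (G s) (fun n => iteratedDeriv n F s) (F s) (by simp) ?_ n
  intro n
  -- F' = G₁F holds on a neighbourhood, so it may be differentiated further; Leibniz's rule then
  -- gives exactly the recursion of `sum_partitionTerm_unique`.
  have h1 : deriv F =ᶠ[𝓝 s] (fun s => G s 1) * F :=
    eventually_of_mem (hU.mem_nhds hs) fun t ht => by
      rw [(hF t ht).deriv, Pi.mul_apply, mul_comm]
  rw [iteratedDeriv_succ', h1.iteratedDeriv_eq, iteratedDeriv_mul (hGc s hs n) (hFc s hs n)]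
  refine Finset.sum_congr rfl fun k _ => ?_
  rw [hGi k s hs]

-- The logarithm of `riceLaplace` is -K + K/(1 + cs) - log(1 + cs); `smallDelta K c i` is its i-th
-- derivative.
open A2G.System in
lemma hasDerivAt_riceLaplace {K c s : ℝ} (h : 1 + c * s ≠ 0) :
    HasDerivAt (riceLaplace K c) (riceLaplace K c s * smallDelta K c 1 s) s := by
  have h1 : HasDerivAt (fun s => 1 + c * s) c s := by
    simpa using ((hasDerivAt_id s).const_mul c).const_add 1
  have h2 : HasDerivAt (fun s => -K + K / (1 + c * s)) (-(K * c) / (1 + c * s) ^ 2) s := by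
    simpa using ((hasDerivAt_const s K).div h1 h).const_add (-K)
  have h3 := h2.exp.div h1 h
  refine h3.congr_deriv ?_
  simp only [riceLaplace, smallDelta]
  field_simp
  simp
  ring

open A2G.System in
lemma hasDerivAt_smallDelta {K c s : ℝ} (h : 1 + c * s ≠ 0) (i : ℕ) (hi : 1 ≤ i) :
    HasDerivAt (smallDelta K c i) (smallDelta K c (i + 1) s) s := by
  have h1 : HasDerivAt (fun s => 1 + c * s) c s := by
    simpa using ((hasDerivAt_id s).const_mul c).const_add 1
  obtain ⟨k, rfl⟩ : ∃ k, i = k + 1 := ⟨i - 1, by omega⟩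
  have h2 := (((hasDerivAt_const s ((-c) ^ (k + 1))).div (h1.pow (k + 1)) (pow_ne_zero _ h)).const_mul
    (((k + 1 - 1)! : ℕ) : ℝ)).mul
    (((hasDerivAt_const s (((k + 1 : ℕ) : ℝ) * K)).div h1 h).const_add 1)
  refine h2.congr_deriv ?_
  simp only [smallDelta, Nat.add_sub_cancel, Nat.factorial_succ]
  simp only [Pi.pow_apply, Pi.div_apply]
  push_cast
  field_simp
  ring

open A2G.System in
lemma contDiffAt_riceLaplace {K c s : ℝ} (h : 1 + c * s ≠ 0) (n : ℕ) :
    ContDiffAt ℝ n (riceLaplace K c) s := by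
  unfold riceLaplace
  fun_prop (disch := assumption)

open A2G.System in
lemma contDiffAt_smallDelta {K c s : ℝ} (h : 1 + c * s ≠ 0) (i n : ℕ) :
    ContDiffAt ℝ n (smallDelta K c i) s := by
  unfold smallDelta
  fun_prop (disch := first | assumption | exact pow_ne_zero _ h)

-- The logarithm turns the product into a sum. The noise factor exp(-s) contributes -1 to the first
-- logarithmic derivative and nothing to the later ones, hence the term at i = 1.
open A2G.System in
theorem iteratedDeriv_prod_riceLaplace {ι : Type*} [Fintype ι] {K c : ι → ℝ} (hc : ∀ x, 0 ≤ c x)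
    (n : ℕ) {s : ℝ} (hs : 0 ≤ s) :
    iteratedDeriv n (fun s => Real.exp (-s) * ∏ x, riceLaplace (K x) (c x) s) s =
      (Real.exp (-s) * ∏ x, riceLaplace (K x) (c x) s) * ∑ p : n.Partition,
        partitionTerm p fun i => (∑ x, smallDelta (K x) (c x) i s) - if i = 1 then 1 else 0 := by
  classical
  -- An open set containing the closed half-line s ≥ 0 on which all denominators are positive, so
  -- that two-sided derivatives make sense at s = 0 too.
  set U : Set ℝ := ⋂ x, {s | 0 < 1 + c x * s} with hU
  have hmem : ∀ s ∈ U, ∀ x, 1 + c x * s ≠ 0 := fun s hs x => (Set.mem_iInter.1 hs x).ne'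
  refine iteratedDeriv_eq_sum_partitionTerm
    (G := fun s i => (∑ x, smallDelta (K x) (c x) i s) - if i = 1 then 1 else 0) (U := U)
    (isOpen_iInter_of_finite fun x => isOpen_lt (by fun_prop) (by fun_prop)) ?_ ?_ ?_ ?_ n ?_
  · intro s hs
    have h1 : HasDerivAt (fun s => ∏ x, riceLaplace (K x) (c x) s)
        ((∏ x, riceLaplace (K x) (c x) s) * ∑ x, smallDelta (K x) (c x) 1 s) s := by
      have := HasDerivAt.fun_finsetProd (u := Finset.univ) (f := fun x => riceLaplace (K x) (c x))
        fun x _ => hasDerivAt_riceLaplace (K := K x) (hmem s hs x)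
      refine this.congr_deriv ?_
      rw [Finset.mul_sum]
      refine Finset.sum_congr rfl fun x hx => ?_
      rw [← Finset.mul_prod_erase _ _ hx, smul_eq_mul]
      ring
    have h2 : HasDerivAt (fun s : ℝ => Real.exp (-s)) (-Real.exp (-s)) s := by
      simpa using (hasDerivAt_neg s).exp
    refine (h2.mul h1).congr_deriv ?_
    simp only [if_true]
    ring
  · intro s hs i hi
    have h := (HasDerivAt.fun_sum (u := Finset.univ) fun x _ =>
      hasDerivAt_smallDelta (K := K x) (hmem s hs x) i hi).sub_const
        (if i = 1 then (1 : ℝ) else 0)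
    refine h.congr_deriv ?_
    rw [if_neg (by omega), sub_zero]
  · intro s hs n
    exact (by fun_prop : ContDiffAt ℝ n (fun s : ℝ => Real.exp (-s)) s).mul
      (contDiffAt_prod fun x _ => contDiffAt_riceLaplace (hmem s hs x) n)
  · intro s hs n
    exact (ContDiffAt.sum fun x _ => contDiffAt_smallDelta (hmem s hs x) 1 n).sub
      contDiffAt_const
  · refine Set.mem_iInter.2 fun x => ?_
    have := mul_nonneg (hc x) hs
    simp only [Set.mem_ofPred_eq]
    linarith

namespace System

variable {N L K : ℕ} (S : System N L K)

/-- Rician factors of all interferers. -/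
def riceInt : Fin L ⊕ Fin K → ℝ := Sum.elim S.riceI S.riceJ

/-- Average interference-to-noise ratios of all interferers. -/
noncomputable def inrInt : Fin L ⊕ Fin K → ℝ := Sum.elim S.inrI S.inrJ

lemma riceInt_nonneg (x : Fin L ⊕ Fin K) : 0 ≤ S.riceInt x := by
  cases x with
  | inl l => exact S.riceI_nonneg l
  | inr k => exact S.riceJ_nonneg k

lemma inrInt_nonneg (x : Fin L ⊕ Fin K) : 0 ≤ S.inrInt x := by
  cases x with
  | inl l => exact div_nonneg (mul_nonneg (S.PI_nonneg l) (S.lossI_pos l).le) S.noise_pos.le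
  | inr k => exact div_nonneg (mul_nonneg (S.PJ_nonneg k) (S.lossJ_pos k).le) S.noise_pos.le

lemma delta0_eq (s : ℝ) :
    S.delta0 s = Real.exp (-s) *
      ∏ x, riceLaplace (S.riceInt x) (S.inrInt x / (S.riceInt x + 1)) s := by
  rw [Fintype.prod_sum_type, ← mul_assoc]
  rfl

theorem iteratedDeriv_delta0 (n : ℕ) {s : ℝ} (hs : 0 ≤ s) :
    iteratedDeriv n S.delta0 s = S.delta n s := by
  have h := iteratedDeriv_prod_riceLaplace (K := S.riceInt)
    (c := fun x => S.inrInt x / (S.riceInt x + 1))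
    (fun x => div_nonneg (S.inrInt_nonneg x) (by linarith [S.riceInt_nonneg x])) n hs
  simp only [← delta0_eq] at h
  rw [show S.delta0 = fun s => S.delta0 s from rfl, h, delta]
  simp only [Fintype.sum_sum_type]
  rfl

end System

/-! ### The Bessel function of order zero -/

lemma integral_cos_pow_odd (k : ℕ) : ∫ θ in (-Real.pi)..Real.pi, Real.cos θ ^ (2 * k + 1) = 0 := by
  induction k with
  | zero => simp
  | succ k ih =>
    rw [show 2 * (k + 1) + 1 = 2 * k + 1 + 2 by ring, integral_cos_pow, ih]
    simp

lemma integral_cos_pow_even (k : ℕ) :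
    ∫ θ in (-Real.pi)..Real.pi, Real.cos θ ^ (2 * k) =
      2 * Real.pi * (2 * k)! / (4 ^ k * (k ! : ℝ) ^ 2) := by
  induction k with
  | zero => simp; ring
  | succ k ih =>
    rw [show 2 * (k + 1) = 2 * k + 2 by ring, integral_cos_pow, ih]
    simp only [Nat.factorial_succ, Real.sin_pi, Real.sin_neg]
    have : (k ! : ℝ) ≠ 0 := by positivity
    push_cast
    field_simp
    ring

/-- Expand the exponential and integrate term by term, dominated by |x|^n / n!. Odd powers of the
cosine integrate to zero and even ones give the Wallis values. -/
lemma hasSum_besselI_zero (x : ℝ) :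
    HasSum (fun k : ℕ => (x / 2) ^ (2 * k) / (k ! : ℝ) ^ 2)
      ((2 * Real.pi)⁻¹ * ∫ θ in (-Real.pi)..Real.pi, Real.exp (x * Real.cos θ)) := by
  have h : HasSum (fun n : ℕ => ∫ θ in (-Real.pi)..Real.pi, (x * Real.cos θ) ^ n / (n ! : ℝ))
      (∫ θ in (-Real.pi)..Real.pi, Real.exp (x * Real.cos θ)) := by
    refine intervalIntegral.hasSum_integral_of_dominated_convergence
      (fun n _ => |x| ^ n / n !) (fun n => ?_) (fun n => ?_) ?_ ?_ ?_
    · exact (by fun_prop : Continuous fun θ : ℝ => (x * Real.cos θ) ^ n / (n ! : ℝ)).aestronglyMeasurable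
    · refine Filter.Eventually.of_forall fun θ _ => ?_
      rw [norm_div, norm_pow, norm_mul, Real.norm_eq_abs, Real.norm_eq_abs, Real.norm_natCast]
      gcongr
      exact mul_le_of_le_one_right (abs_nonneg _) (Real.abs_cos_le_one θ)
    · exact Filter.Eventually.of_forall fun θ _ => Real.summable_pow_div_factorial |x|
    · simp
    · refine Filter.Eventually.of_forall fun θ _ => ?_
      rw [Real.exp_eq_exp_ℝ]
      exact NormedSpace.expSeries_div_hasSum_exp (x * Real.cos θ)
  have hn : ∀ n : ℕ, ∫ θ in (-Real.pi)..Real.pi, (x * Real.cos θ) ^ n / (n ! : ℝ) =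
      x ^ n / n ! * ∫ θ in (-Real.pi)..Real.pi, Real.cos θ ^ n := by
    intro n
    rw [← intervalIntegral.integral_const_mul]
    congr 1
    ext θ
    rw [mul_pow]; ring
  simp_rw [hn] at h
  have hinj : Function.Injective fun k : ℕ => 2 * k := fun a b h => by simpa using h
  have h2 := (hinj.hasSum_iff (f := fun n : ℕ => x ^ n / n ! *
      ∫ θ in (-Real.pi)..Real.pi, Real.cos θ ^ n) ?_).2 h
  · have h3 := h2.mul_left (2 * Real.pi)⁻¹
    refine h3.congr_fun fun k => ?_
    simp only [Function.comp]
    rw [integral_cos_pow_even, div_pow, pow_mul 2 2 k]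
    have hk : (k ! : ℝ) ≠ 0 := by positivity
    have hk2 : ((2 * k)! : ℝ) ≠ 0 := by positivity
    have hpi := Real.pi_ne_zero
    norm_num
    field_simp
  · intro n hn
    obtain ⟨k, rfl | rfl⟩ := Nat.even_or_odd' n
    · exact absurd ⟨k, rfl⟩ hn
    · simp [integral_cos_pow_odd]

lemma besselI_zero_eq_tsum (x : ℝ) :
    besselI 0 x = ∑' k : ℕ, (x / 2) ^ (2 * k) / (k ! : ℝ) ^ 2 := by
  simp only [besselI, add_zero, sq]

theorem integral_exp_mul_cos (x : ℝ) :
    ∫ θ in (-Real.pi)..Real.pi, Real.exp (x * Real.cos θ) = 2 * Real.pi * besselI 0 x := by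
  rw [besselI_zero_eq_tsum, (hasSum_besselI_zero x).tsum_eq]
  field_simp

lemma continuous_besselI_zero : Continuous (besselI 0) := by
  have : besselI 0 = fun x => (2 * Real.pi)⁻¹ *
      ∫ θ in (-Real.pi)..Real.pi, Real.exp (x * Real.cos θ) := by
    ext x
    rw [besselI_zero_eq_tsum, (hasSum_besselI_zero x).tsum_eq]
  rw [this]
  refine continuous_const.mul (intervalIntegral.continuous_parametric_intervalIntegral_of_continuous'
    (by fun_prop) _ _)

lemma besselI_zero_pos (x : ℝ) : 0 < besselI 0 x := by
  rw [besselI_zero_eq_tsum]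
  refine (hasSum_besselI_zero x).summable.tsum_pos (fun k => ?_) 0 (by simp)
  rw [pow_mul]
  positivity

/-- By periodicity the phase shift η does not change the integral over a full period; η will be the
argument of the Gaussian mean. -/
lemma lintegral_exp_mul_cos_sub (x η : ℝ) :
    ∫⁻ θ in Set.Ioo (-Real.pi) Real.pi, ENNReal.ofReal (Real.exp (x * Real.cos (θ - η))) =
      ENNReal.ofReal (2 * Real.pi * besselI 0 x) := by
  have hc : Continuous fun θ : ℝ => Real.exp (x * Real.cos (θ - η)) := by fun_prop
  rw [Measure.restrict_congr_set Ioo_ae_eq_Ioc, ← ofReal_integral_eq_lintegral_ofReal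
    (hc.integrableOn_Ioc) (Filter.Eventually.of_forall fun θ => (Real.exp_pos _).le),
    ← intervalIntegral.integral_of_le (by linarith [Real.pi_pos]), ← integral_exp_mul_cos]
  congr 1
  rw [intervalIntegral.integral_comp_sub_right (fun θ => Real.exp (x * Real.cos θ)) η]
  have hp : Function.Periodic (fun θ => Real.exp (x * Real.cos θ)) (2 * Real.pi) := fun θ => by
    simp
  have := hp.intervalIntegral_add_eq (-Real.pi - η) (-Real.pi)
  rw [show -Real.pi - η + 2 * Real.pi = Real.pi - η by ring,
    show -Real.pi + 2 * Real.pi = Real.pi by ring] at this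
  exact this

/-! ### The complex Gaussian law in polar coordinates -/

lemma lintegral_complexGaussian {v : ℝ} (hv : 0 < v) {f : ℂ → ENNReal} (hf : Measurable f) :
    ∫⁻ z, f z ∂complexGaussian v =
      ∫⁻ z, ENNReal.ofReal ((Real.pi * v)⁻¹ * Real.exp (-‖z‖ ^ 2 / v)) * f z := by
  have hv' : (v / 2).toNNReal ≠ 0 := by simpa using hv
  have hm : Measurable fun q : ℝ × ℝ => (⟨q.1, q.2⟩ : ℂ) :=
    Complex.measurableEquivRealProd.symm.measurable
  rw [complexGaussian, lintegral_map hf hm, gaussianReal_of_var_ne_zero _ hv',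
    prod_withDensity (measurable_gaussianPDF _ _) (measurable_gaussianPDF _ _),
    lintegral_withDensity_eq_lintegral_mul _ ?_ (g := fun q : ℝ × ℝ => f ⟨q.1, q.2⟩) (hf.comp hm)]
  · rw [← (Complex.volume_preserving_equiv_real_prod.symm).lintegral_comp_emb
      Complex.measurableEquivRealProd.symm.measurableEmbedding]
    refine lintegral_congr fun q => ?_
    rw [Pi.mul_apply]
    congr 1
    rw [gaussianPDF, gaussianPDF, ← ENNReal.ofReal_mul (gaussianPDFReal_nonneg _ _ _)]
    congr 1
    have h1 : ‖Complex.measurableEquivRealProd.symm q‖ ^ 2 = q.1 ^ 2 + q.2 ^ 2 := by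
      rw [Complex.sq_norm, Complex.normSq_apply]
      simp [Complex.measurableEquivRealProd, sq]
    rw [h1, gaussianPDFReal, gaussianPDFReal, Real.coe_toNNReal _ (by positivity)]
    have h2 : √(2 * Real.pi * (v / 2)) * √(2 * Real.pi * (v / 2)) = Real.pi * v := by
      rw [Real.mul_self_sqrt (by positivity)]; ring
    calc _ = (√(2 * Real.pi * (v / 2)) * √(2 * Real.pi * (v / 2)))⁻¹ *
          (Real.exp (-(q.1 - 0) ^ 2 / (2 * (v / 2))) * Real.exp (-(q.2 - 0) ^ 2 / (2 * (v / 2)))) := by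
            rw [mul_inv]; ring
      _ = _ := by
        rw [h2, ← Real.exp_add]
        congr 2
        field_simp
        ring
  · exact (measurable_gaussianPDF _ _).comp measurable_fst |>.mul
      ((measurable_gaussianPDF _ _).comp measurable_snd)

instance isProbabilityMeasure_complexGaussian (v : ℝ) :
    IsProbabilityMeasure (complexGaussian v) := by
  rw [complexGaussian]
  exact Measure.isProbabilityMeasure_map
    (Complex.measurableEquivRealProd.symm.measurable).aemeasurable

/-- The law of the modulus of a complex Gaussian variable with mean `a`. -/
theorem lintegral_norm_add_complexGaussian {v : ℝ} (hv : 0 < v) (a : ℂ) {f : ℝ → ENNReal}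
    (hf : Measurable f) :
    ∫⁻ z, f ‖z + a‖ ∂complexGaussian v = ∫⁻ r in Set.Ioi 0, f r * ENNReal.ofReal
      (2 * r / v * Real.exp (-(r ^ 2 + ‖a‖ ^ 2) / v) * besselI 0 (2 * ‖a‖ * r / v)) := by
  rw [lintegral_complexGaussian hv (f := fun z => f ‖z + a‖) (hf.comp (by fun_prop))]
  have h1 : ∫⁻ z : ℂ, ENNReal.ofReal ((Real.pi * v)⁻¹ * Real.exp (-‖z‖ ^ 2 / v)) * f ‖z + a‖ =
      ∫⁻ w : ℂ, ENNReal.ofReal ((Real.pi * v)⁻¹ * Real.exp (-‖w - a‖ ^ 2 / v)) * f ‖w‖ := by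
    rw [← lintegral_add_right_eq_self (μ := volume) (fun w : ℂ => ENNReal.ofReal
      ((Real.pi * v)⁻¹ * Real.exp (-‖w - a‖ ^ 2 / v)) * f ‖w‖) a]
    simp
  -- Law of cosines: the angle enters the Gaussian density only through one cosine, so the angular
  -- integral is a Bessel function.
  have hn : ∀ r θ : ℝ, ‖(r * (Real.cos θ + Real.sin θ * Complex.I) : ℂ) - a‖ ^ 2 =
      r ^ 2 + ‖a‖ ^ 2 - 2 * ‖a‖ * r * Real.cos (θ - Complex.arg a) := by
    intro r θ
    have ha1 := Complex.norm_mul_cos_arg a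
    have ha2 := Complex.norm_mul_sin_arg a
    rw [Complex.sq_norm, Complex.normSq_apply, Real.cos_sub]
    have ha3 : ‖a‖ ^ 2 = a.re ^ 2 + a.im ^ 2 := by
      rw [Complex.sq_norm, Complex.normSq_apply]; ring
    have e1 : ((r * (Real.cos θ + Real.sin θ * Complex.I) : ℂ) - a).re = r * Real.cos θ - a.re := by
      simp [-Complex.ofReal_cos, -Complex.ofReal_sin]
    have e2 : ((r * (Real.cos θ + Real.sin θ * Complex.I) : ℂ) - a).im = r * Real.sin θ - a.im := by
      simp [-Complex.ofReal_cos, -Complex.ofReal_sin]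
    rw [e1, e2, ha3]
    have hcs := Real.sin_sq_add_cos_sq θ
    rw [← ha1, ← ha2]
    linear_combination r ^ 2 * hcs
  rw [h1, ← Complex.lintegral_comp_polarCoord_symm]
  simp only [Complex.norm_polarCoord_symm]
  simp only [Complex.polarCoord_symm_apply, hn, smul_eq_mul,
    polarCoord_target]
  rw [Measure.volume_eq_prod, ← Measure.prod_restrict, lintegral_prod]
  · refine setLIntegral_congr_fun measurableSet_Ioi fun r hr => ?_
    have hr : 0 < r := hr
    simp only [abs_of_pos hr]
    have e : ∀ θ : ℝ, ENNReal.ofReal r * (ENNReal.ofReal ((Real.pi * v)⁻¹ * Real.exp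
        (-(r ^ 2 + ‖a‖ ^ 2 - 2 * ‖a‖ * r * Real.cos (θ - Complex.arg a)) / v)) * f r) =
        f r * (ENNReal.ofReal (r * ((Real.pi * v)⁻¹ * Real.exp (-(r ^ 2 + ‖a‖ ^ 2) / v))) *
          ENNReal.ofReal (Real.exp ((2 * ‖a‖ * r / v) * Real.cos (θ - Complex.arg a)))) := by
      intro θ
      rw [← ENNReal.ofReal_mul (by positivity), ← mul_assoc, ← ENNReal.ofReal_mul hr.le, mul_comm]
      congr 2
      rw [mul_assoc r, mul_assoc _ (Real.exp _), ← Real.exp_add]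
      congr 3
      ring
    simp_rw [e]
    rw [lintegral_const_mul _ (by fun_prop), lintegral_const_mul _ (by fun_prop),
      lintegral_exp_mul_cos_sub, ← ENNReal.ofReal_mul (by positivity)]
    congr 2
    have := Real.pi_ne_zero
    field_simp
  · refine Measurable.aemeasurable ?_
    fun_prop

/-! ### Kummer's transformation -/

lemma descPochhammer_smeval_eq_eval (n : ℕ) (x : ℝ) :
    (descPochhammer ℤ n).smeval x = (descPochhammer ℝ n).eval x := by
  rw [← descPochhammer_map (algebraMap ℤ ℝ), Polynomial.eval_map, ← Polynomial.aeval_def,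
    Polynomial.aeval_eq_smeval]

/-- Vandermonde's identity for falling factorials, applied to the sum n + (-(1 + k)). This is the
coefficient comparison behind Kummer's transformation. -/
lemma sum_choose_mul_ascPochhammer (k : ℝ) (n : ℕ) :
    ∑ ij ∈ Finset.HasAntidiagonal.antidiagonal n, (n.choose ij.1 : ℝ) * (((n ! : ℝ) / (ij.2)!) *
      ((-1) ^ ij.2 * (ascPochhammer ℝ ij.2).eval (1 + k))) = (ascPochhammer ℝ n).eval (-k) := by
  have h := Ring.descPochhammer_smeval_add (r := (n : ℝ)) (s := -(1 + k)) n (Commute.all _ _)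
  rw [descPochhammer_smeval_eq_eval, descPochhammer_eval_eq_ascPochhammer,
    show (n : ℝ) + -(1 + k) - n + 1 = -k by ring] at h
  rw [h]
  refine Finset.sum_congr rfl fun ij hij => ?_
  rw [Finset.HasAntidiagonal.mem_antidiagonal] at hij
  rw [Polynomial.descPochhammer_smeval_eq_descFactorial, descPochhammer_smeval_eq_eval]
  have h1 := ascPochhammer_eval_neg_eq_descPochhammer ℝ (-(1 + k)) ij.2
  rw [neg_neg] at h1
  rw [h1, ← mul_assoc ((-1 : ℝ) ^ _), ← mul_pow]
  have h2 : (n.descFactorial ij.1 : ℝ) = (n ! : ℝ) / (ij.2)! := by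
    rw [eq_div_iff (by positivity), ← hij]
    have := Nat.factorial_mul_descFactorial (Nat.le_add_right ij.1 ij.2)
    rw [Nat.add_sub_cancel_left] at this
    rw [mul_comm]
    exact_mod_cast this
  rw [h2]
  norm_num

lemma ascPochhammer_one_add_nonneg {k : ℝ} (hk : 0 ≤ k) (n : ℕ) :
    0 ≤ (ascPochhammer ℝ n).eval (1 + k) := (ascPochhammer_pos n _ (by linarith)).le

/-- Each factor satisfies 1 + k + i ≤ (i + 1)(1 + k). The bound lets the exponential series dominate
the Kummer series. -/
lemma ascPochhammer_one_add_le {k : ℝ} (hk : 0 ≤ k) (n : ℕ) :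
    (ascPochhammer ℝ n).eval (1 + k) ≤ n ! * (1 + k) ^ n := by
  induction n with
  | zero => simp
  | succ n ih =>
    rw [ascPochhammer_succ_eval, Nat.factorial_succ, pow_succ]
    push_cast
    calc _ ≤ (n ! * (1 + k) ^ n) * ((n + 1) * (1 + k)) := by
          gcongr
          nlinarith [mul_nonneg hk (Nat.cast_nonneg (α := ℝ) n)]
      _ = _ := by ring

lemma summable_kummer {k x : ℝ} (hk : 0 ≤ k) :
    Summable fun n : ℕ => ‖(ascPochhammer ℝ n).eval (1 + k) / (n ! : ℝ) ^ 2 * x ^ n‖ := by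
  refine Summable.of_nonneg_of_le (fun _ => norm_nonneg _) (fun n => ?_)
    (Real.summable_pow_div_factorial ((1 + k) * |x|))
  rw [norm_mul, norm_div, norm_pow, norm_pow, Real.norm_of_nonneg (ascPochhammer_one_add_nonneg hk n),
    Real.norm_natCast, Real.norm_eq_abs]
  have h : (n ! : ℝ) ≠ 0 := by positivity
  calc _ ≤ (n ! * (1 + k) ^ n) / (n ! : ℝ) ^ 2 * |x| ^ n := by
        gcongr
        exact ascPochhammer_one_add_le hk n
    _ = _ := by
      rw [mul_pow]
      field_simp

/-- Kummer's transformation `e^{-x} ₁F₁(1+k; 1; x) = ₁F₁(-k; 1; -x)`. -/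
theorem exp_neg_mul_tsum_eq_laguerreFn {k : ℝ} (hk : 0 ≤ k) (x : ℝ) :
    Real.exp (-x) * ∑' n : ℕ, (ascPochhammer ℝ n).eval (1 + k) / (n ! : ℝ) ^ 2 * x ^ n =
      laguerreFn k (-x) := by
  have he : Real.exp (-x) = ∑' n : ℕ, (-x) ^ n / (n ! : ℝ) := by
    rw [Real.exp_eq_exp_ℝ, NormedSpace.exp_eq_tsum_div]
  have hes : Summable fun n : ℕ => ‖(-x) ^ n / (n ! : ℝ)‖ :=
    (Real.summable_pow_div_factorial (-x)).norm
  rw [he, tsum_mul_tsum_eq_tsum_sum_antidiagonal_of_summable_norm hes (summable_kummer hk),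
    laguerreFn]
  refine tsum_congr fun n => ?_
  rw [← sum_choose_mul_ascPochhammer, Finset.sum_div, Finset.sum_mul]
  refine Finset.sum_congr rfl fun ij hij => ?_
  rw [Finset.HasAntidiagonal.mem_antidiagonal] at hij
  obtain ⟨i, j⟩ := ij
  simp only at hij ⊢
  subst hij
  rw [Nat.cast_choose ℝ (Nat.le_add_right i j), Nat.add_sub_cancel_left, neg_pow x i,
    neg_pow x (i + j), pow_add, pow_add]
  have h1 : (i ! : ℝ) ≠ 0 := by positivity
  have h2 : (j ! : ℝ) ≠ 0 := by positivity
  have h3 : ((i + j)! : ℝ) ≠ 0 := by positivity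
  have h4 : ((-1 : ℝ) ^ j) * (-1) ^ j = 1 := by rw [← mul_pow]; norm_num
  field_simp
  linear_combination (-(x ^ i * x ^ j * (ascPochhammer ℝ j).eval (1 + k))) * h4

lemma Gamma_add_natCast_add_one {k : ℝ} (hk : 0 ≤ k) (n : ℕ) :
    Real.Gamma (n + 1 + k) = Real.Gamma (1 + k) * (ascPochhammer ℝ n).eval (1 + k) := by
  induction n with
  | zero => simp
  | succ n ih =>
    rw [ascPochhammer_succ_eval, ← mul_assoc, ← ih]
    push_cast
    rw [show (n : ℝ) + 1 + 1 + k = (n + 1 + k) + 1 by ring, Real.Gamma_add_one (by positivity)]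
    ring

/-! ### Gamma laws -/

lemma lintegral_gammaMeasure (a r : ℝ) {f : ℝ → ENNReal} (hf : Measurable f) :
    ∫⁻ x, f x ∂gammaMeasure a r = ∫⁻ x in Set.Ioi 0,
      ENNReal.ofReal (r ^ a / Real.Gamma a * x ^ (a - 1) * Real.exp (-(r * x))) * f x := by
  have hm : Measurable (gammaPDF a r) := (measurable_gammaPDFReal a r).ennreal_ofReal
  rw [gammaMeasure, lintegral_withDensity_eq_lintegral_mul _ hm hf,
    ← lintegral_add_compl _ measurableSet_Ici, Set.compl_Ici,
    setLIntegral_congr_fun (g := fun _ => 0) measurableSet_Iio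
      (fun x (hx : x < 0) => by rw [Pi.mul_apply, gammaPDF_of_neg hx, zero_mul]),
    lintegral_zero, add_zero, Measure.restrict_congr_set Ioi_ae_eq_Ici.symm]
  refine setLIntegral_congr_fun measurableSet_Ioi fun x hx => ?_
  rw [Pi.mul_apply, gammaPDF_of_nonneg (le_of_lt hx)]

lemma lintegral_Ioi_gamma_density {a r : ℝ} (ha : 0 < a) (hr : 0 < r) :
    ∫⁻ x in Set.Ioi 0, ENNReal.ofReal (r ^ a / Real.Gamma a * x ^ (a - 1) * Real.exp (-(r * x))) =
      1 := by
  have := isProbabilityMeasure_gammaMeasure ha hr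
  have h := lintegral_gammaMeasure a r (f := fun _ => 1) measurable_const
  simpa using h.symm

/-- Multiplying a Gamma density by x^k gives, up to a constant, the density with shape a + k, which
has total mass one. -/
lemma lintegral_rpow_gammaMeasure {a r k : ℝ} (ha : 0 < a) (hr : 0 < r) (hk : 0 ≤ k) :
    ∫⁻ x, ENNReal.ofReal (x ^ k) ∂gammaMeasure a r =
      ENNReal.ofReal (Real.Gamma (a + k) / (Real.Gamma a * r ^ k)) := by
  have hG := Real.Gamma_pos_of_pos ha
  have hG' := Real.Gamma_pos_of_pos (show 0 < a + k by linarith)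
  rw [lintegral_gammaMeasure a r (by fun_prop), ← mul_one (ENNReal.ofReal (_ / _)),
    ← lintegral_Ioi_gamma_density (show 0 < a + k by linarith) hr, ← lintegral_const_mul _
      (by fun_prop)]
  refine setLIntegral_congr_fun measurableSet_Ioi fun x hx => ?_
  have hx : 0 < x := hx
  have h1 := Real.rpow_pos_of_pos hr k
  rw [← ENNReal.ofReal_mul (by positivity), ← ENNReal.ofReal_mul (by positivity)]
  congr 1
  rw [show a + k - 1 = (a - 1) + k by ring, Real.rpow_add hx, Real.rpow_add hr]
  field_simp

lemma lintegral_exp_neg_mul_gammaMeasure {a r s : ℝ} (ha : 0 < a) (hr : 0 < r) (hs : 0 ≤ s) :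
    ∫⁻ x, ENNReal.ofReal (Real.exp (-s * x)) ∂gammaMeasure a r =
      ENNReal.ofReal ((r / (r + s)) ^ a) := by
  have hG := Real.Gamma_pos_of_pos ha
  have hrs : 0 < r + s := by linarith
  rw [lintegral_gammaMeasure a r (by fun_prop), ← mul_one (ENNReal.ofReal (_ ^ _)),
    ← lintegral_Ioi_gamma_density ha hrs, ← lintegral_const_mul _ (by fun_prop)]
  refine setLIntegral_congr_fun measurableSet_Ioi fun x hx => ?_
  have hx : 0 < x := hx
  have h1 := Real.rpow_pos_of_pos hrs a
  rw [← ENNReal.ofReal_mul (by positivity), ← ENNReal.ofReal_mul (by positivity)]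
  congr 1
  rw [Real.div_rpow hr.le hrs.le, show -((r + s) * x) = -(r * x) + -s * x by ring, Real.exp_add]
  field_simp

/-! ### Squared modulus of a complex Gaussian variable as a Poisson mixture of Gamma laws -/

/-- The Poisson weight of `n` at rate `x`. -/
noncomputable def poissonWeight (x : ℝ) (n : ℕ) : ℝ := Real.exp (-x) * x ^ n / n !

lemma poissonWeight_nonneg {x : ℝ} (hx : 0 ≤ x) (n : ℕ) : 0 ≤ poissonWeight x n := by
  unfold poissonWeight
  positivity

lemma lintegral_Ioi_comp_sq (g : ℝ → ENNReal) :
    ∫⁻ y in Set.Ioi 0, g y = ∫⁻ r in Set.Ioi (0 : ℝ), ENNReal.ofReal (2 * r) * g (r ^ 2) := by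
  have himg : (fun r : ℝ => r ^ 2) '' Set.Ioi 0 = Set.Ioi 0 := by
    ext y
    constructor
    · rintro ⟨r, hr, rfl⟩
      exact pow_pos (Set.mem_Ioi.1 hr) 2
    · intro hy
      exact ⟨√y, Real.sqrt_pos.2 hy, Real.sq_sqrt (le_of_lt hy)⟩
  have h := lintegral_image_eq_lintegral_abs_deriv_mul (s := Set.Ioi (0 : ℝ))
    (f := fun r => r ^ 2) (f' := fun r => 2 * r) measurableSet_Ioi
    (fun r _ => by simpa using (hasDerivAt_pow 2 r).hasDerivWithinAt)
    (fun x hx y hy h => by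
      exact (pow_left_inj₀ (le_of_lt hx) (le_of_lt hy) two_ne_zero).1 h) g
  rw [himg] at h
  rw [h]
  refine setLIntegral_congr_fun measurableSet_Ioi fun r hr => ?_
  have hr : 0 < r := hr
  rw [abs_of_pos (by positivity)]

/-- In the radial density, the n-th term of the Bessel series has a factor r^(2n). After the
substitution y = r² it is a Gamma density of shape n + 1, and the remaining constant is the Poisson
weight at rate ‖a‖²/v. -/
theorem lintegral_sq_norm_add_complexGaussian {v : ℝ} (hv : 0 < v) (a : ℂ) {f : ℝ → ENNReal}
    (hf : Measurable f) :
    ∫⁻ z, f (‖z + a‖ ^ 2) ∂complexGaussian v =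
      ∑' n : ℕ, ENNReal.ofReal (poissonWeight (‖a‖ ^ 2 / v) n) *
        ∫⁻ y, f y ∂gammaMeasure (n + 1) (1 / v) := by
  rw [lintegral_norm_add_complexGaussian hv a (f := fun r => f (r ^ 2)) (hf.comp (by fun_prop))]
  have h1 : ∀ n : ℕ, ENNReal.ofReal (poissonWeight (‖a‖ ^ 2 / v) n) *
      ∫⁻ y, f y ∂gammaMeasure (n + 1) (1 / v) = ∫⁻ r in Set.Ioi (0 : ℝ),
        ENNReal.ofReal (poissonWeight (‖a‖ ^ 2 / v) n) * (ENNReal.ofReal (2 * r) *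
          (ENNReal.ofReal ((1 / v) ^ ((n : ℝ) + 1) / Real.Gamma (n + 1) *
            (r ^ 2) ^ ((n : ℝ) + 1 - 1) * Real.exp (-(1 / v * r ^ 2))) * f (r ^ 2))) := by
    intro n
    rw [lintegral_gammaMeasure _ _ hf, lintegral_Ioi_comp_sq, ← lintegral_const_mul _ (by fun_prop)]
  simp_rw [h1]
  rw [← lintegral_tsum fun n => (by fun_prop)]
  refine setLIntegral_congr_fun measurableSet_Ioi fun r hr => ?_
  have hr : 0 < r := hr
  have h2 : ∀ n : ℕ, ENNReal.ofReal (poissonWeight (‖a‖ ^ 2 / v) n) * (ENNReal.ofReal (2 * r) *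
          (ENNReal.ofReal ((1 / v) ^ ((n : ℝ) + 1) / Real.Gamma (n + 1) *
            (r ^ 2) ^ ((n : ℝ) + 1 - 1) * Real.exp (-(1 / v * r ^ 2))) * f (r ^ 2))) =
      f (r ^ 2) * ENNReal.ofReal (2 * r / v * Real.exp (-(r ^ 2 + ‖a‖ ^ 2) / v) *
        ((2 * ‖a‖ * r / v / 2) ^ (2 * n) / (n ! : ℝ) ^ 2)) := by
    intro n
    have hp := poissonWeight_nonneg (show 0 ≤ ‖a‖ ^ 2 / v by positivity) n
    rw [← mul_assoc (ENNReal.ofReal (2 * r)), ← mul_assoc, ← ENNReal.ofReal_mul (by positivity),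
      ← ENNReal.ofReal_mul hp, mul_comm]
    congr 2
    rw [Real.Gamma_nat_eq_factorial, add_sub_cancel_right, Real.rpow_natCast,
      Real.rpow_add_one (by positivity), Real.rpow_natCast, poissonWeight,
      show -(r ^ 2 + ‖a‖ ^ 2) / v = -(‖a‖ ^ 2 / v) + -(1 / v * r ^ 2) by ring, Real.exp_add,
      pow_mul]
    have hn : (n ! : ℝ) ≠ 0 := by positivity
    rw [show (2 * ‖a‖ * r / v / 2) ^ 2 = (‖a‖ ^ 2 / v) * (1 / v) * r ^ 2 by field_simp,
      mul_pow, mul_pow]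
    field_simp
  simp_rw [h2]
  rw [ENNReal.tsum_mul_left]
  congr 1
  rw [besselI_zero_eq_tsum, ← tsum_mul_left, ENNReal.ofReal_tsum_of_nonneg]
  · intro n
    have : 0 ≤ (2 * ‖a‖ * r / v / 2) ^ (2 * n) := by positivity
    positivity
  · exact (hasSum_besselI_zero _).summable.mul_left _

/-! ### Rician coefficients -/

lemma measurable_ricianFading_map (K : ℝ) (u : ℂ) :
    Measurable fun z : ℂ => ((√K : ℝ) * u + z) / ((√(K + 1) : ℝ) : ℂ) := by fun_prop

instance isProbabilityMeasure_ricianFading (K : ℝ) (u : ℂ) :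
    IsProbabilityMeasure (ricianFading K u) :=
  Measure.isProbabilityMeasure_map (measurable_ricianFading_map K u).aemeasurable

lemma norm_ricianFading_map (K : ℝ) (u z : ℂ) :
    ‖((√K : ℝ) * u + z) / ((√(K + 1) : ℝ) : ℂ)‖ = ‖z + (√K : ℝ) * u‖ / √(K + 1) := by
  rw [norm_div, Complex.norm_real, Real.norm_of_nonneg (Real.sqrt_nonneg _), add_comm]

lemma norm_sqrt_mul {K : ℝ} {u : ℂ} (hu : ‖u‖ = 1) : ‖((√K : ℝ) : ℂ) * u‖ = √K := by
  rw [norm_mul, hu, mul_one, Complex.norm_real, Real.norm_of_nonneg (Real.sqrt_nonneg _)]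

lemma lintegral_sq_norm_ricianFading {K : ℝ} (hK : 0 ≤ K) {u : ℂ} (hu : ‖u‖ = 1)
    {f : ℝ → ENNReal} (hf : Measurable f) :
    ∫⁻ z, f (‖z‖ ^ 2) ∂ricianFading K u = ∑' n : ℕ, ENNReal.ofReal (poissonWeight K n) *
      ∫⁻ y, f (y / (K + 1)) ∂gammaMeasure (n + 1) 1 := by
  rw [ricianFading, lintegral_map (f := fun z : ℂ => f (‖z‖ ^ 2)) (hf.comp (by fun_prop))
    (measurable_ricianFading_map K u)]
  simp_rw [norm_ricianFading_map, div_pow, Real.sq_sqrt (show 0 ≤ K + 1 by linarith)]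
  rw [lintegral_sq_norm_add_complexGaussian one_pos _ (f := fun y => f (y / (K + 1)))
    (hf.comp (by fun_prop)), norm_sqrt_mul hu, Real.sq_sqrt hK]
  simp

lemma tsum_ofReal_mul_ofReal {w c : ℕ → ℝ} {S : ℝ} (hw : ∀ n, 0 ≤ w n) (hc : ∀ n, 0 ≤ c n)
    (h : HasSum (fun n => w n * c n) S) :
    ∑' n, ENNReal.ofReal (w n) * ENNReal.ofReal (c n) = ENNReal.ofReal S := by
  rw [← h.tsum_eq, ENNReal.ofReal_tsum_of_nonneg (fun n => mul_nonneg (hw n) (hc n)) h.summable]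
  exact tsum_congr fun n => (ENNReal.ofReal_mul (hw n)).symm

/-- The Gamma moments are Γ(1 + k)(1 + k)_n / n!, so their Poisson average is a multiple of e^(-K)
₁F₁(1 + k; 1; K); Kummer's transformation makes it the Laguerre function at -K. -/
theorem lintegral_rpow_ricianFading {K k : ℝ} (hK : 0 ≤ K) (hk : 0 ≤ k) {u : ℂ} (hu : ‖u‖ = 1) :
    ∫⁻ z, ENNReal.ofReal ((‖z‖ ^ 2) ^ k) ∂ricianFading K u =
      ENNReal.ofReal (System.momRice K k) := by
  have hK1 : 0 < (K + 1) := by linarith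
  have hKk := Real.rpow_pos_of_pos hK1 k
  have hG : 0 < Real.Gamma (1 + k) := Real.Gamma_pos_of_pos (by linarith)
  rw [lintegral_sq_norm_ricianFading hK hu (f := fun y => ENNReal.ofReal (y ^ k)) (by fun_prop)]
  have h1 : ∀ n : ℕ, ∫⁻ y, ENNReal.ofReal ((y / (K + 1)) ^ k) ∂gammaMeasure (n + 1) 1 =
      ENNReal.ofReal (Real.Gamma (1 + k) * (ascPochhammer ℝ n).eval (1 + k) / n ! / (K + 1) ^ k) := by
    intro n
    have hn : (0 : ℝ) < n + 1 := by positivity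
    have h2 : ∫⁻ y, ENNReal.ofReal ((y / (K + 1)) ^ k) ∂gammaMeasure (n + 1) 1 =
        ∫⁻ y, ENNReal.ofReal (((K + 1) ^ k)⁻¹) * ENNReal.ofReal (y ^ k) ∂gammaMeasure (n + 1) 1 := by
      rw [lintegral_gammaMeasure _ _ (by fun_prop), lintegral_gammaMeasure _ _ (by fun_prop)]
      refine setLIntegral_congr_fun measurableSet_Ioi fun y hy => ?_
      have hy : 0 < y := hy
      rw [Real.div_rpow hy.le hK1.le, ← ENNReal.ofReal_mul (inv_nonneg.2 hKk.le),
        div_eq_inv_mul (y ^ k)]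
    rw [h2, lintegral_const_mul _ (by fun_prop), lintegral_rpow_gammaMeasure hn one_pos hk,
      ← ENNReal.ofReal_mul (by positivity), Gamma_add_natCast_add_one hk,
      Real.Gamma_nat_eq_factorial, Real.one_rpow]
    congr 1
    field_simp
  simp_rw [h1]
  refine tsum_ofReal_mul_ofReal (poissonWeight_nonneg hK) (fun n => ?_) ?_
  · have := ascPochhammer_one_add_nonneg hk n
    positivity
  · have h := ((summable_kummer (x := K) hk).of_norm.hasSum.mul_left (Real.exp (-K))).mul_left
      (Real.Gamma (1 + k) / (1 + K) ^ k)
    rw [exp_neg_mul_tsum_eq_laguerreFn hk] at h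
    have e : System.momRice K k = Real.Gamma (1 + k) / (1 + K) ^ k * laguerreFn k (-K) := by
      rw [System.momRice]; ring
    rw [e]
    refine h.congr_fun fun n => ?_
    rw [poissonWeight, add_comm K 1]
    have hn : (n ! : ℝ) ≠ 0 := by positivity
    field_simp

lemma hasSum_poissonWeight_mul_pow (x q : ℝ) :
    HasSum (fun n => poissonWeight x n * q ^ n) (Real.exp (-x + x * q)) := by
  have h : HasSum (fun n : ℕ => (x * q) ^ n / (n ! : ℝ)) (Real.exp (x * q)) := by
    rw [Real.exp_eq_exp_ℝ]
    exact NormedSpace.expSeries_div_hasSum_exp (x * q)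
  rw [Real.exp_add]
  refine (h.mul_left (Real.exp (-x))).congr_fun fun n => ?_
  rw [poissonWeight, mul_pow]
  ring

/-- Laplace transform of the squared modulus of a complex Gaussian variable with mean `a`. -/
theorem lintegral_exp_neg_sq_norm_add_complexGaussian {v s : ℝ} (hv : 0 < v) (hs : 0 ≤ s) (a : ℂ) :
    ∫⁻ z, ENNReal.ofReal (Real.exp (-s * ‖z + a‖ ^ 2)) ∂complexGaussian v =
      ENNReal.ofReal (System.riceLaplace (‖a‖ ^ 2 / v) v s) := by
  have hvs : 0 < 1 + v * s := by positivity
  rw [lintegral_sq_norm_add_complexGaussian hv a (f := fun y => ENNReal.ofReal (Real.exp (-s * y)))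
    (by fun_prop)]
  have h1 : ∀ n : ℕ, ∫⁻ y, ENNReal.ofReal (Real.exp (-s * y)) ∂gammaMeasure (n + 1) (1 / v) =
      ENNReal.ofReal ((1 + v * s)⁻¹ ^ n * (1 + v * s)⁻¹) := by
    intro n
    rw [lintegral_exp_neg_mul_gammaMeasure (by positivity) (by positivity) hs]
    congr 1
    rw [← pow_succ, show (n : ℝ) + 1 = ((n + 1 : ℕ) : ℝ) by push_cast; rfl, Real.rpow_natCast]
    congr 1
    field_simp
  simp_rw [h1]
  refine tsum_ofReal_mul_ofReal (poissonWeight_nonneg (by positivity)) (fun n => by positivity) ?_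
  have h := (hasSum_poissonWeight_mul_pow (‖a‖ ^ 2 / v) (1 + v * s)⁻¹).mul_right (1 + v * s)⁻¹
  rw [System.riceLaplace, div_eq_mul_inv _ (1 + v * s), div_eq_mul_inv (‖a‖ ^ 2 / v) (1 + v * s)]
  exact h.congr_fun fun n => by ring

theorem lintegral_exp_neg_sq_norm_ricianFading {K c s : ℝ} (hK : 0 ≤ K) (hc : 0 ≤ c) (hs : 0 ≤ s)
    {u : ℂ} (hu : ‖u‖ = 1) :
    ∫⁻ z, ENNReal.ofReal (Real.exp (-s * (c * ‖z‖ ^ 2))) ∂ricianFading K u =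
      ENNReal.ofReal (System.riceLaplace K (c / (K + 1)) s) := by
  have hK1 : 0 < K + 1 := by linarith
  rw [ricianFading, lintegral_map (by fun_prop) (measurable_ricianFading_map K u)]
  simp_rw [norm_ricianFading_map, div_pow, Real.sq_sqrt hK1.le]
  have h := lintegral_exp_neg_sq_norm_add_complexGaussian one_pos
    (show 0 ≤ s * c / (K + 1) by positivity) (((√K : ℝ) : ℂ) * u)
  rw [norm_sqrt_mul hu, Real.sq_sqrt hK] at h
  rw [show System.riceLaplace K (c / (K + 1)) s = System.riceLaplace (K / 1) 1 (s * c / (K + 1)) by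
    simp only [System.riceLaplace]
    rw [show 1 + c / (K + 1) * s = 1 + 1 * (s * c / (K + 1)) by ring, div_one], ← h]
  refine lintegral_congr fun z => ?_
  congr 2
  ring

/-- The power moments of a Rician coefficient above a threshold. -/
theorem lintegral_indicator_norm_pow_ricianFading {K b : ℝ} (hK : 0 ≤ K) (hb : 0 ≤ b) {u : ℂ}
    (hu : ‖u‖ = 1) (i : ℕ) :
    ∫⁻ z, Set.indicator {z : ℂ | b ≤ √(2 * (K + 1)) * ‖z‖}
      (fun z => ENNReal.ofReal ((√(2 * (K + 1)) * ‖z‖) ^ i)) z ∂ricianFading K u =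
      ∫⁻ t in Set.Ioi b, ENNReal.ofReal
        (t ^ (i + 1) * Real.exp (-(t ^ 2 + √(2 * K) ^ 2) / 2) * besselI 0 (√(2 * K) * t)) := by
  have hK1 : 0 < K + 1 := by linarith
  have hK1' : 0 < √(K + 1) := Real.sqrt_pos.2 hK1
  have h2 : 0 < √(2 : ℝ) := Real.sqrt_pos.2 two_pos
  -- The event is closed at b while the Nuttall integral runs over the open half-line; the two agree
  -- because a point is null.
  set g : ℝ → ENNReal := Set.indicator (Set.Ici b) (fun t => ENNReal.ofReal (t ^ i)) with hg
  have hgm : Measurable g := Measurable.indicator (by fun_prop) measurableSet_Ici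
  have e1 : ∀ z : ℂ, Set.indicator {z : ℂ | b ≤ √(2 * (K + 1)) * ‖z‖}
      (fun z => ENNReal.ofReal ((√(2 * (K + 1)) * ‖z‖) ^ i)) z = g (√(2 * (K + 1)) * ‖z‖) :=
    fun z => rfl
  simp_rw [e1]
  rw [ricianFading, lintegral_map (f := fun z : ℂ => g (√(2 * (K + 1)) * ‖z‖))
    (hgm.comp (by fun_prop)) (measurable_ricianFading_map K u)]
  have e2 : ∀ z : ℂ, √(2 * (K + 1)) * ‖((√K : ℝ) * u + z) / ((√(K + 1) : ℝ) : ℂ)‖ =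
      √2 * ‖z + (√K : ℝ) * u‖ := by
    intro z
    rw [norm_ricianFading_map, Real.sqrt_mul zero_le_two]
    field_simp
  simp_rw [e2]
  rw [lintegral_norm_add_complexGaussian one_pos _ (f := fun r => g (√2 * r))
    (hgm.comp (by fun_prop)), norm_sqrt_mul hu, Real.sq_sqrt hK]
  have himg : (fun r : ℝ => √2 * r) '' Set.Ioi 0 = Set.Ioi 0 := by
    rw [Set.image_mul_left_Ioi h2, mul_zero]
  -- The substitution t = √2 r passes from a Gaussian with variance 1/2 per real component to the
  -- standard normalization of the Nuttall function.
  have h3 := lintegral_image_eq_lintegral_abs_deriv_mul (s := Set.Ioi (0 : ℝ))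
    (f := fun r => √2 * r) (f' := fun _ => √2) measurableSet_Ioi
    (fun r _ => by simpa using ((hasDerivAt_id r).const_mul (√2)).hasDerivWithinAt)
    (fun x _ y _ h => mul_left_cancel₀ h2.ne' h)
    (fun t => g t * ENNReal.ofReal (t * Real.exp (-(t ^ 2 + √(2 * K) ^ 2) / 2) *
      besselI 0 (√(2 * K) * t)))
  rw [himg] at h3
  have h4 : ∫⁻ t in Set.Ioi b, ENNReal.ofReal
        (t ^ (i + 1) * Real.exp (-(t ^ 2 + √(2 * K) ^ 2) / 2) * besselI 0 (√(2 * K) * t)) =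
      ∫⁻ t in Set.Ioi 0, g t * ENNReal.ofReal (t * Real.exp (-(t ^ 2 + √(2 * K) ^ 2) / 2) *
        besselI 0 (√(2 * K) * t)) := by
    rw [Measure.restrict_congr_set (Ioi_ae_eq_Ici (a := b)),
      Measure.restrict_congr_set (Ioi_ae_eq_Ici (a := (0 : ℝ))), ← lintegral_indicator measurableSet_Ici,
      ← lintegral_indicator measurableSet_Ici]
    refine lintegral_congr fun t => ?_
    by_cases ht : b ≤ t
    · have h0 : 0 ≤ t := hb.trans ht
      rw [Set.indicator_of_mem (show t ∈ Set.Ici b from ht),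
        Set.indicator_of_mem (show t ∈ Set.Ici 0 from h0), hg,
        Set.indicator_of_mem (show t ∈ Set.Ici b from ht), ← ENNReal.ofReal_mul (by positivity)]
      congr 1
      ring
    · rw [Set.indicator_of_notMem (show t ∉ Set.Ici b from ht), Set.indicator_apply]
      split_ifs
      · rw [hg, Set.indicator_of_notMem (show t ∉ Set.Ici b from ht), zero_mul]
      · rfl
  rw [h4, h3]
  refine setLIntegral_congr_fun measurableSet_Ioi fun r hr => ?_
  have hr : 0 < r := hr
  rw [mul_left_comm, ← ENNReal.ofReal_mul (abs_nonneg _), abs_of_pos h2]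
  congr 2
  have s2 : √2 * √2 = (2 : ℝ) := Real.mul_self_sqrt zero_le_two
  rw [Real.sq_sqrt (by positivity), mul_pow, Real.sq_sqrt zero_le_two, Real.sqrt_mul zero_le_two,
    show √2 * √K * (√2 * r) = 2 * √K * r / 1 by linear_combination √K * r * s2,
    show -(2 * r ^ 2 + 2 * K) / 2 = -(r ^ 2 + K) / 1 by ring]
  linear_combination (-(r * Real.exp (-(r ^ 2 + K) / 1) * besselI 0 (2 * √K * r / 1))) * s2

/-! ### General facts on expectations and independence -/

/-- Moments are computed as integrals in [0, ∞], where no integrability is needed; a finite value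
then yields both integrability and the real integral. -/
lemma integrable_and_integral_eq_of_lintegral {α : Type*} [MeasurableSpace α] {μ : Measure α}
    {f : α → ℝ} (hf : AEStronglyMeasurable f μ) (h0 : 0 ≤ᵐ[μ] f) {c : ℝ} (hc : 0 ≤ c)
    (h : ∫⁻ x, ENNReal.ofReal (f x) ∂μ = ENNReal.ofReal c) :
    Integrable f μ ∧ ∫ x, f x ∂μ = c := by
  refine ⟨⟨hf, ?_⟩, ?_⟩
  · rw [hasFiniteIntegral_iff_ofReal h0, h]
    exact ENNReal.ofReal_lt_top
  · rw [integral_eq_lintegral_of_nonneg_ae h0 hf, h, ENNReal.toReal_ofReal hc]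

/-- Functions of disjoint subfamilies are independent. A function depending only on the coordinates
in S factors through the restriction to S, by extending the restricted family with zeros. -/
lemma indepFun_of_dependsOn {ι Ω α β : Type*} [MeasurableSpace Ω] [MeasurableSpace α]
    [MeasurableSpace β] {P : Measure Ω} {h : ι → Ω → ℂ} (hi : iIndepFun h P)
    (hm : ∀ i, Measurable (h i)) {S T : Finset ι} (hST : Disjoint S T) {F : (ι → ℂ) → α}
    {G : (ι → ℂ) → β} (hF : Measurable F) (hG : Measurable G) (hFS : DependsOn F (S : Set ι))
    (hGT : DependsOn G (T : Set ι)) :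
    IndepFun (fun ω => F fun i => h i ω) (fun ω => G fun i => h i ω) P := by
  classical
  have key : ∀ (S : Finset ι), Measurable fun (y : S → ℂ) (i : ι) =>
      if hi : i ∈ S then y ⟨i, hi⟩ else 0 := by
    intro S
    refine measurable_pi_lambda _ fun i => ?_
    by_cases hi : i ∈ S
    · simpa [hi] using measurable_pi_apply _
    · simp [hi]
  have h1 := (iIndepFun.indepFun_finset S T hST hi hm).comp (hF.comp (key S)) (hG.comp (key T))
  have e1 : (fun ω => F fun i => h i ω) = (F ∘ fun (y : S → ℂ) (i : ι) =>
      if hi : i ∈ S then y ⟨i, hi⟩ else 0) ∘ fun ω (i : S) => h i ω := by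
    ext ω
    refine hFS fun i hi => ?_
    have hi' : i ∈ S := hi
    simp [hi']
  have e2 : (fun ω => G fun i => h i ω) = (G ∘ fun (y : T → ℂ) (i : ι) =>
      if hi : i ∈ T then y ⟨i, hi⟩ else 0) ∘ fun ω (i : T) => h i ω := by
    ext ω
    refine hGT fun i hi => ?_
    have hi' : i ∈ T := hi
    simp [hi']
  rw [e1, e2]
  exact h1

lemma sq_rpow_half {x : ℝ} (hx : 0 ≤ x) (j : ℕ) : (x ^ 2) ^ ((j : ℝ) / 2) = x ^ j := by
  rw [← Real.rpow_natCast x 2, ← Real.rpow_mul hx, ← Real.rpow_natCast]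
  congr 1
  push_cast
  ring

lemma rpow_half_eq_sqrt_pow (x : ℝ) (hx : 0 ≤ x) (j : ℕ) : x ^ ((j : ℝ) / 2) = √x ^ j := by
  rw [← sq_rpow_half (Real.sqrt_nonneg x), Real.sq_sqrt hx]

/-- Moments of sums of independent variables with equal moments. -/
theorem integral_sum_pow_eq_coeff_egf {ι Ω : Type*} [MeasurableSpace Ω] {P : Measure Ω}
    [IsProbabilityMeasure P] {X : ι → Ω → ℝ} {μ : ℕ → ℝ}
    (hμ : ∀ i j, Integrable (fun ω => X i ω ^ j) P ∧ ∫ ω, X i ω ^ j ∂P = μ j) (s : Finset ι)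
    (hind : ∀ i ∈ s, ∀ t ⊆ s, i ∉ t → IndepFun (X i) (fun ω => ∑ l ∈ t, X l ω) P) (j : ℕ) :
    Integrable (fun ω => (∑ l ∈ s, X l ω) ^ j) P ∧
      ∫ ω, (∑ l ∈ s, X l ω) ^ j ∂P = (j ! : ℝ) * PowerSeries.coeff j (egf μ ^ s.card) := by
  classical
  induction s using Finset.induction_on generalizing j with
  | empty => cases j <;> simp [PowerSeries.coeff_one]
  | insert i s his ih =>
    have ih' := ih fun l hl t ht hlt => hind l (Finset.mem_insert_of_mem hl) t
      (ht.trans (Finset.subset_insert i s)) hlt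
    have hi := hind i (Finset.mem_insert_self i s) s (Finset.subset_insert i s) his
    have hpow : ∀ a b : ℕ, IndepFun (fun ω => X i ω ^ a) (fun ω => (∑ l ∈ s, X l ω) ^ b) P :=
      fun a b => hi.comp (show Measurable fun x : ℝ => x ^ a by fun_prop)
        (show Measurable fun x : ℝ => x ^ b by fun_prop)
    have hint : ∀ a b : ℕ, Integrable (fun ω => X i ω ^ a * (∑ l ∈ s, X l ω) ^ b) P := fun a b =>
      (hpow a b).integrable_mul (hμ i a).1 (ih' b).1
    simp_rw [Finset.sum_insert his, add_pow]
    refine ⟨integrable_finsetSum _ fun m _ => (hint _ _).mul_const _, ?_⟩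
    rw [integral_finsetSum _ fun m _ => (hint _ _).mul_const _, Finset.card_insert_of_notMem his,
      pow_succ', PowerSeries.coeff_mul, Finset.Nat.sum_antidiagonal_eq_sum_range_succ_mk,
      Finset.mul_sum]
    refine Finset.sum_congr rfl fun m hm => ?_
    have hm' : m ≤ j := by rw [Finset.mem_range] at hm; omega
    rw [integral_mul_const, (hpow m (j - m)).integral_fun_mul_eq_mul_integral
      (hμ i m).1.aestronglyMeasurable (ih' (j - m)).1.aestronglyMeasurable, (ih' (j - m)).2,
      (hμ i m).2, Nat.cast_choose ℝ hm']
    have h1 : (m ! : ℝ) ≠ 0 := by positivity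
    have h2 : ((j - m)! : ℝ) ≠ 0 := by positivity
    -- At index 0 the value 1 built into `egf` agrees with `μ 0`, since P has total mass one.
    have h3 : PowerSeries.coeff m (egf μ) = μ m / m ! := by
      rcases Nat.eq_zero_or_pos m with rfl | h
      · have := (hμ i 0).2
        simp at this
        simp [egf, ← this]
      · simp [egf, h.ne']
    simp only [h3]
    field_simp

/-! ### Constants of the system -/

namespace System

variable {N L K : ℕ} (S : System N L K)

lemma rice_nonneg (e : Link N L K) : 0 ≤ S.rice e := by
  cases e with
  | ur n => exact S.riceUR_nonneg
  | rd n => exact S.riceRD_nonneg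
  | ud => exact S.riceUD_nonneg
  | aerial l => exact S.riceI_nonneg l
  | ground k => exact S.riceJ_nonneg k

lemma snrCas_pos : 0 < S.snrCas := by
  have := S.PU_pos
  have := S.lossUR_pos
  have := S.lossRD_pos
  have := S.refl_pos
  have := S.noise_pos
  unfold snrCas
  positivity

lemma snrDir_pos : 0 < S.snrDir := by
  have := S.PU_pos
  have := S.lossUD_pos
  have := S.noise_pos
  unfold snrDir
  positivity

lemma lamUD_pos : 0 < S.lamUD :=
  div_pos (by linarith [S.riceUD_nonneg]) S.lossUD_pos

end System

/-- The sign is not visible in the Laguerre series; after Kummer's transformation all terms are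
nonnegative. -/
lemma momRice_nonneg {K k : ℝ} (hK : 0 ≤ K) (hk : 0 ≤ k) : 0 ≤ System.momRice K k := by
  have h := exp_neg_mul_tsum_eq_laguerreFn hk K
  have h1 : 0 ≤ laguerreFn k (-K) := by
    rw [← h]
    refine mul_nonneg (Real.exp_pos _).le (tsum_nonneg fun n => ?_)
    have := ascPochhammer_one_add_nonneg hk n
    positivity
  have := Real.Gamma_pos_of_pos (show 0 < 1 + k by linarith)
  unfold System.momRice
  positivity

lemma riceLaplace_pos {K c s : ℝ} (hc : 0 ≤ c) (hs : 0 ≤ s) : 0 < System.riceLaplace K c s := by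
  unfold System.riceLaplace
  positivity

/-! ### The Nuttall function as a truncated moment -/

lemma nuttallQ_integrand_nonneg {a t : ℝ} (ht : 0 ≤ t) (i : ℕ) :
    0 ≤ t ^ i * Real.exp (-(t ^ 2 + a ^ 2) / 2) * besselI 0 (a * t) := by
  have := besselI_zero_pos (a * t)
  positivity

theorem lintegral_indicator_norm_pow_eq_nuttallQ {K b : ℝ} (hK : 0 ≤ K) (hb : 0 ≤ b) {u : ℂ}
    (hu : ‖u‖ = 1) (i : ℕ) :
    ∫⁻ z, Set.indicator {z : ℂ | b ≤ √(2 * (K + 1)) * ‖z‖}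
      (fun z => ENNReal.ofReal ((√(2 * (K + 1)) * ‖z‖) ^ i)) z ∂ricianFading K u =
      ENNReal.ofReal (nuttallQ (i + 1) 0 √(2 * K) b) := by
  have h := lintegral_indicator_norm_pow_ricianFading hK hb hu i
  -- The truncated moment is bounded by a full Rician moment. Finiteness makes the integrand of
  -- `nuttallQ` integrable, so its Bochner integral is the true value and not the default 0.
  have hfin : ∫⁻ z, Set.indicator {z : ℂ | b ≤ √(2 * (K + 1)) * ‖z‖}
      (fun z => ENNReal.ofReal ((√(2 * (K + 1)) * ‖z‖) ^ i)) z ∂ricianFading K u < ⊤ := by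
    calc _ ≤ ∫⁻ z, ENNReal.ofReal (√(2 * (K + 1)) ^ i) * ENNReal.ofReal
          ((‖z‖ ^ 2) ^ ((i : ℝ) / 2)) ∂ricianFading K u := by
          refine lintegral_mono fun z => (Set.indicator_le_self _ _ _).trans_eq ?_
          rw [mul_pow, ENNReal.ofReal_mul (by positivity), sq_rpow_half (norm_nonneg z)]
      _ < ⊤ := by
        rw [lintegral_const_mul _ (by fun_prop),
          lintegral_rpow_ricianFading hK (by positivity) hu]
        exact ENNReal.mul_lt_top ENNReal.ofReal_lt_top ENNReal.ofReal_lt_top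
  rw [h] at hfin ⊢
  have hnn : 0 ≤ᵐ[volume.restrict (Set.Ioi b)] fun t : ℝ =>
      t ^ (i + 1) * Real.exp (-(t ^ 2 + √(2 * K) ^ 2) / 2) * besselI 0 (√(2 * K) * t) := by
    refine (ae_restrict_iff' measurableSet_Ioi).2 (Filter.Eventually.of_forall fun t ht => ?_)
    exact nuttallQ_integrand_nonneg (hb.trans (le_of_lt ht)) _
  rw [nuttallQ, ofReal_integral_eq_lintegral_ofReal ⟨?_, ?_⟩ hnn]
  · have := continuous_besselI_zero
    exact Continuous.aestronglyMeasurable (by fun_prop)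
  · rwa [hasFiniteIntegral_iff_ofReal hnn]

lemma nuttallQ_nonneg (i : ℕ) (a : ℝ) {b : ℝ} (hb : 0 ≤ b) : 0 ≤ nuttallQ i 0 a b :=
  setIntegral_nonneg measurableSet_Ioi fun _ ht =>
    nuttallQ_integrand_nonneg (hb.trans (le_of_lt ht)) _

/-- This value will be the probability of an unblocked link; positivity keeps the division by 1 - β
meaningful. -/
lemma nuttallQ_one_pos {K b : ℝ} (hK : 0 ≤ K) (hb : 0 ≤ b) : 0 < nuttallQ 1 0 √(2 * K) b := by
  have h := lintegral_indicator_norm_pow_eq_nuttallQ hK hb (u := 1) (by simp) 0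
  rw [lintegral_indicator_norm_pow_ricianFading hK hb (by simp) 0] at h
  rw [zero_add] at h
  rw [← ENNReal.ofReal_pos, ← h, setLIntegral_pos_iff]
  · have : Set.Ioi b ⊆ (Function.support fun t : ℝ => ENNReal.ofReal (t ^ 1 *
        Real.exp (-(t ^ 2 + √(2 * K) ^ 2) / 2) * besselI 0 (√(2 * K) * t))) ∩ Set.Ioi b := by
      refine fun t ht => ⟨?_, ht⟩
      have ht0 : 0 < t := hb.trans_lt ht
      have := besselI_zero_pos (√(2 * K) * t)
      rw [Function.mem_support, ← pos_iff_ne_zero, ENNReal.ofReal_pos]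
      positivity
    refine lt_of_lt_of_le ?_ (measure_mono this)
    simp
  · have := continuous_besselI_zero
    exact (Continuous.measurable (by fun_prop)).ennreal_ofReal

/-! ### Blockage probability and steady state -/

namespace System

variable {N L K : ℕ} (S : System N L K)

lemma sqrt_le_iff_not_blocked (z : ℂ) :
    √(2 * S.lamUD * S.τ) ≤ √(2 * (S.riceUD + 1)) * ‖z‖ ↔ ¬ S.lossUD * ‖z‖ ^ 2 < S.τ := by
  have hK : 0 < S.riceUD + 1 := by linarith [S.riceUD_nonneg]
  have hl := S.lossUD_pos
  rw [not_lt, Real.sqrt_le_left (by positivity), mul_pow, Real.sq_sqrt (by positivity), lamUD]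
  rw [show 2 * ((S.riceUD + 1) / S.lossUD) * S.τ = (2 * (S.riceUD + 1) / S.lossUD) * S.τ by ring,
    show 2 * (S.riceUD + 1) * ‖z‖ ^ 2 = (2 * (S.riceUD + 1) / S.lossUD) * (S.lossUD * ‖z‖ ^ 2) by
      field_simp]
  exact mul_le_mul_iff_right₀ (by positivity)

lemma measurableSet_blocked : MeasurableSet {z : ℂ | S.lossUD * ‖z‖ ^ 2 < S.τ} :=
  measurableSet_lt (by fun_prop) (by fun_prop)

/-- The truncated moment of order zero is the probability of the complement of the blocking event.
-/
theorem blockProb_eq :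
    S.blockProb = 1 - nuttallQ 1 0 √(2 * S.riceUD) √(2 * S.lamUD * S.τ) := by
  have h := lintegral_indicator_norm_pow_eq_nuttallQ S.riceUD_nonneg
    (Real.sqrt_nonneg (2 * S.lamUD * S.τ)) (S.norm_los .ud) 0
  have hset : {z : ℂ | √(2 * S.lamUD * S.τ) ≤ √(2 * (S.riceUD + 1)) * ‖z‖} =
      {z : ℂ | S.lossUD * ‖z‖ ^ 2 < S.τ}ᶜ := by
    ext z
    exact S.sqrt_le_iff_not_blocked z
  simp only [hset, pow_zero, ENNReal.ofReal_one] at h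
  rw [lintegral_indicator S.measurableSet_blocked.compl, setLIntegral_one] at h
  have h2 := measureReal_compl (μ := ricianFading S.riceUD (S.los .ud)) S.measurableSet_blocked
  rw [measureReal_def _ (_ᶜ), h, ENNReal.toReal_ofReal (nuttallQ_nonneg _ _ (Real.sqrt_nonneg _))]
    at h2
  rw [blockProb]
  simp at h2 ⊢
  linarith

/-- The transition probabilities p₀₁ = 1 - β and p₁₀ = β sum to one, so π₁ = 1 - β, and this is
nonzero by positivity of the Marcum function. -/
lemma steady_one_div : S.steady 1 / (1 - S.blockProb) = 1 := by
  have h : 0 < 1 - S.blockProb := by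
    rw [S.blockProb_eq]
    have := nuttallQ_one_pos S.riceUD_nonneg (Real.sqrt_nonneg (2 * S.lamUD * S.τ))
    linarith
  have e : S.steady 1 = 1 - S.blockProb := by
    simp [steady, transition]
  rw [e, div_self h.ne']

end System

/-! ### Moments of the coefficients and of the cascaded link -/

namespace Channels

variable {N L K : ℕ} {S : System N L K} {Ω : Type*} [MeasurableSpace Ω] {P : Measure Ω}
  (C : Channels S P)

lemma lintegral_comp_h (e : Link N L K) {f : ℂ → ENNReal} (hf : Measurable f) :
    ∫⁻ ω, f (C.h e ω) ∂P = ∫⁻ z, f z ∂ricianFading (S.rice e) (S.los e) := by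
  rw [← (C.law_h e).map_eq, lintegral_map hf (C.measurable_h e)]

theorem integral_norm_h_pow (e : Link N L K) (j : ℕ) :
    Integrable (fun ω => ‖C.h e ω‖ ^ j) P ∧
      ∫ ω, ‖C.h e ω‖ ^ j ∂P = System.momRice (S.rice e) ((j : ℝ) / 2) := by
  have := C.measurable_h e
  refine integrable_and_integral_eq_of_lintegral
    (Measurable.aestronglyMeasurable (by fun_prop)) (Filter.Eventually.of_forall fun ω => by
      simp only [Pi.zero_apply]; positivity) (momRice_nonneg (S.rice_nonneg e) (by positivity)) ?_
  rw [C.lintegral_comp_h e (f := fun z => ENNReal.ofReal (‖z‖ ^ j)) (by fun_prop),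
    ← lintegral_rpow_ricianFading (S.rice_nonneg e) (by positivity) (S.norm_los e)]
  simp_rw [sq_rpow_half (norm_nonneg _)]

/-! Independence of the gains -/

lemma indepFun_h {e e' : Link N L K} (h : e ≠ e') : IndepFun (C.h e) (C.h e') P :=
  C.indep_h.indepFun h

open scoped Classical in
lemma indepFun_cas_summand {i : Fin N} {t : Finset (Fin N)} (hi : i ∉ t) :
    IndepFun (fun ω => ‖C.h (.ur i) ω‖ * ‖C.h (.rd i) ω‖)
      (fun ω => ∑ l ∈ t, ‖C.h (.ur l) ω‖ * ‖C.h (.rd l) ω‖) P := by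
  refine indepFun_of_dependsOn C.indep_h C.measurable_h (S := {.ur i, .rd i})
    (T := t.image .ur ∪ t.image .rd) ?_
    (F := fun x => ‖x (.ur i)‖ * ‖x (.rd i)‖) (G := fun x => ∑ l ∈ t, ‖x (.ur l)‖ * ‖x (.rd l)‖)
    (by fun_prop) (by fun_prop) ?_ ?_
  · rw [Finset.disjoint_left]
    intro e he
    simp only [Finset.mem_insert, Finset.mem_singleton] at he
    rcases he with rfl | rfl <;> simpa using hi
  · intro x y hxy
    simp only
    rw [hxy (.ur i) (by simp), hxy (.rd i) (by simp)]
  · intro x y hxy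
    refine Finset.sum_congr rfl fun l hl => ?_
    rw [hxy (.ur l) (by simp [hl]), hxy (.rd l) (by simp [hl])]

/-- The power j/2 undoes the square, leaving the j-th moment of a sum of N independent products with
common moments; `coeff_egf_pow` expands it over partitions. -/
theorem integral_gCas_rpow [IsProbabilityMeasure P] (j : ℕ) :
    Integrable (fun ω => C.gCas ω ^ ((j : ℝ) / 2)) P ∧
      ∫ ω, C.gCas ω ^ ((j : ℝ) / 2) ∂P = S.momCas j := by
  have h := integral_sum_pow_eq_coeff_egf (P := P)
    (X := fun n ω => ‖C.h (.ur n) ω‖ * ‖C.h (.rd n) ω‖)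
    (μ := fun i => System.momRice S.riceUR ((i : ℝ) / 2) * System.momRice S.riceRD ((i : ℝ) / 2))
    (fun n i => ?_) Finset.univ
    (fun n _ t _ hn => C.indepFun_cas_summand hn) j
  · rw [coeff_egf_pow, Finset.card_univ, Fintype.card_fin] at h
    have e : ∀ ω, C.gCas ω ^ ((j : ℝ) / 2) = (∑ n, ‖C.h (.ur n) ω‖ * ‖C.h (.rd n) ω‖) ^ j :=
      fun ω => sq_rpow_half (by positivity) j
    simp_rw [e]
    exact h
  · have h1 := C.integral_norm_h_pow (.ur n) i
    have h2 := C.integral_norm_h_pow (.rd n) i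
    have hi : IndepFun (fun ω => ‖C.h (.ur n) ω‖ ^ i) (fun ω => ‖C.h (.rd n) ω‖ ^ i) P :=
      (C.indepFun_h (e := .ur n) (e' := .rd n) (by simp)).comp
        (show Measurable fun z : ℂ => ‖z‖ ^ i by fun_prop)
        (show Measurable fun z : ℂ => ‖z‖ ^ i by fun_prop)
    simp_rw [mul_pow]
    refine ⟨hi.integrable_mul h1.1 h2.1, ?_⟩
    rw [hi.integral_fun_mul_eq_mul_integral h1.1.aestronglyMeasurable h2.1.aestronglyMeasurable,
      h1.2, h2.2]
    rfl

end Channels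

namespace Channels

variable {N L K : ℕ} {S : System N L K} {Ω : Type*} [MeasurableSpace Ω] {P : Measure Ω}
  (C : Channels S P)

/-! ### The direct link -/

lemma gCas_nonneg (ω : Ω) : 0 ≤ C.gCas ω := sq_nonneg _

lemma gDir_nonneg (ω : Ω) : 0 ≤ C.gDir ω := by
  unfold gDir
  positivity

lemma gDirN_nonneg (ω : Ω) : 0 ≤ C.gDirN ω :=
  div_nonneg (mul_nonneg (C.gDir_nonneg ω) S.snrDir_pos.le) S.snrCas_pos.le

lemma inr_nonneg (ω : Ω) : 0 ≤ C.inr ω :=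
  add_nonneg
    (Finset.sum_nonneg fun l _ => mul_nonneg (S.inrInt_nonneg (.inl l)) (sq_nonneg _))
    (Finset.sum_nonneg fun k _ => mul_nonneg (S.inrInt_nonneg (.inr k)) (sq_nonneg _))

lemma measurable_gCas : Measurable C.gCas := by
  have := C.measurable_h
  unfold gCas
  fun_prop

lemma measurable_gDir : Measurable C.gDir := by
  have := C.measurable_h
  have h2 : Measurable fun ω => ((C.state 0 ω : ℕ) : ℝ) :=
    (measurable_of_finite (fun i : Fin 2 => ((i : ℕ) : ℝ))).comp (C.measurable_state 0)
  unfold gDir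
  fun_prop

lemma measurable_gDirN : Measurable C.gDirN :=
  (C.measurable_gDir.mul_const _).div_const _

lemma measurable_gA2G : Measurable C.gA2G := by
  have := C.measurable_gCas
  have := C.measurable_gDirN
  unfold gA2G
  simp only [sq_abs]
  fun_prop

lemma measurable_inr : Measurable C.inr := by
  have := C.measurable_h
  unfold inr
  fun_prop

/-- The power gain of the direct link, as a function of its coefficient. -/
noncomputable def dirGain (S : System N L K) (z : ℂ) : ℝ :=
  Set.indicator {z : ℂ | S.lossUD * ‖z‖ ^ 2 < S.τ}ᶜ (fun z => ‖z‖ ^ 2) z * S.snrDir / S.snrCas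

lemma measurable_dirGain : Measurable (dirGain S) :=
  ((Measurable.indicator (by fun_prop) S.measurableSet_blocked.compl).mul_const _).div_const _

/-- The initial state is almost surely determined by the direct coefficient, so the gain becomes a
function of that coefficient alone. Moments and independence are both derived from this version. -/
lemma gDirN_ae_eq : C.gDirN =ᵐ[P] fun ω => dirGain S (C.h .ud ω) := by
  filter_upwards [C.blocked_iff] with ω hω
  rw [gDirN, dirGain, gDir]
  congr 2
  by_cases h : C.state 0 ω = 0
  · rw [Set.indicator_of_notMem (by simpa using hω.1 h), h]
    simp
  · have h1 : C.state 0 ω = 1 := by omega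
    rw [Set.indicator_of_mem (by simpa using mt hω.2 h), h1]
    simp

lemma dirGain_rpow {i : ℕ} (hi : i ≠ 0) (z : ℂ) :
    ENNReal.ofReal (dirGain S z ^ ((i : ℝ) / 2)) =
      ENNReal.ofReal (((2 * S.lamUD * S.noise * S.snrCas / S.PU) ^ ((i : ℝ) / 2))⁻¹) *
        Set.indicator {z : ℂ | √(2 * S.lamUD * S.τ) ≤ √(2 * (S.riceUD + 1)) * ‖z‖}
          (fun z => ENNReal.ofReal ((√(2 * (S.riceUD + 1)) * ‖z‖) ^ i)) z := by
  -- A blocked link has gain 0, whose power must vanish. For i = 0 the convention 0^0 = 1 would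
  -- break the formula, which is why `momDir` treats that index separately.
  have hi2 : ((i : ℝ) / 2) ≠ 0 := by positivity
  by_cases h : S.lossUD * ‖z‖ ^ 2 < S.τ
  · rw [Set.indicator_of_notMem, dirGain, Set.indicator_of_notMem]
    · simp [Real.zero_rpow hi2]
    · simpa using h
    · simpa using (S.sqrt_le_iff_not_blocked z).not.2 (not_not.2 h)
  · have hc := S.snrCas_pos
    have hl := S.lossUD_pos
    have hp := S.PU_pos
    have hn := S.noise_pos
    have hK : 0 < S.riceUD + 1 := by linarith [S.riceUD_nonneg]
    have hlam := S.lamUD_pos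
    have hmem : z ∈ {z : ℂ | √(2 * S.lamUD * S.τ) ≤ √(2 * (S.riceUD + 1)) * ‖z‖} :=
      (S.sqrt_le_iff_not_blocked z).2 h
    rw [Set.indicator_of_mem hmem, dirGain,
      Set.indicator_of_mem (by simpa using h), ← ENNReal.ofReal_mul (by positivity),
      ← sq_rpow_half (show 0 ≤ √(2 * (S.riceUD + 1)) * ‖z‖ by positivity),
      ← Real.inv_rpow (by positivity), ← Real.mul_rpow (by positivity) (by positivity), mul_pow,
      Real.sq_sqrt (by positivity)]
    congr 2
    rw [System.snrDir, System.lamUD]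
    field_simp

theorem integral_gDirN_rpow [IsProbabilityMeasure P] (i : ℕ) :
    Integrable (fun ω => C.gDirN ω ^ ((i : ℝ) / 2)) P ∧
      ∫ ω, C.gDirN ω ^ ((i : ℝ) / 2) ∂P = S.momDir i := by
  rcases eq_or_ne i 0 with rfl | hi
  · simp [System.momDir]
  have hc := S.snrCas_pos
  have hp := S.PU_pos
  have hn := S.noise_pos
  have hlam := S.lamUD_pos
  have hb : 0 ≤ 2 * S.lamUD * S.noise * S.snrCas / S.PU := by positivity
  have hb' := Real.rpow_nonneg hb ((i : ℝ) / 2)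
  have hQ := nuttallQ_nonneg (i + 1) √(2 * S.riceUD) (Real.sqrt_nonneg (2 * S.lamUD * S.τ))
  have hm := C.measurable_gDirN
  refine integrable_and_integral_eq_of_lintegral
    (Measurable.aestronglyMeasurable (by fun_prop)) (Filter.Eventually.of_forall fun ω =>
      Real.rpow_nonneg (C.gDirN_nonneg ω) _) ?_ ?_
  · rw [System.momDir, if_neg hi, S.steady_one_div]
    positivity
  · have h1 : ∫⁻ ω, ENNReal.ofReal (C.gDirN ω ^ ((i : ℝ) / 2)) ∂P =
        ∫⁻ ω, ENNReal.ofReal (dirGain S (C.h .ud ω) ^ ((i : ℝ) / 2)) ∂P := by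
      refine lintegral_congr_ae ?_
      filter_upwards [C.gDirN_ae_eq] with ω hω
      rw [hω]
    have hmd := measurable_dirGain (S := S)
    rw [h1, C.lintegral_comp_h .ud (f := fun z => ENNReal.ofReal (dirGain S z ^ ((i : ℝ) / 2)))
      (by fun_prop)]
    simp_rw [dirGain_rpow hi]
    rw [lintegral_const_mul']
    · have h2 := lintegral_indicator_norm_pow_eq_nuttallQ S.riceUD_nonneg
        (Real.sqrt_nonneg (2 * S.lamUD * S.τ)) (S.norm_los .ud) i
      rw [show S.rice .ud = S.riceUD from rfl, h2, ← ENNReal.ofReal_mul (by positivity),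
        System.momDir, if_neg hi, S.steady_one_div, one_mul, div_eq_inv_mul (nuttallQ _ _ _ _)]
    · exact ENNReal.ofReal_ne_top

/-! ### The combined gain and the interference -/

open scoped Classical in
/-- The links of the cascaded channel. -/
noncomputable def casLinks (N L K : ℕ) : Finset (Link N L K) :=
  Finset.univ.image .ur ∪ Finset.univ.image .rd

open scoped Classical in
/-- The links of the interferers. -/
noncomputable def intLinks (N L K : ℕ) : Finset (Link N L K) :=
  Finset.univ.image .aerial ∪ Finset.univ.image .ground

lemma indepFun_gCas_gDirN : IndepFun C.gCas C.gDirN P := by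
  classical
  have hd := measurable_dirGain (S := S)
  refine IndepFun.congr (f := C.gCas) ?_ (Filter.EventuallyEq.refl _ _) C.gDirN_ae_eq.symm
  refine indepFun_of_dependsOn C.indep_h C.measurable_h (S := casLinks N L K) (T := {.ud}) ?_
    (F := fun x => (∑ n, ‖x (.ur n)‖ * ‖x (.rd n)‖) ^ 2) (G := fun x => dirGain S (x .ud))
    (by fun_prop) (by fun_prop) ?_ ?_
  · simp [casLinks]
  · intro x y hxy
    simp only
    congr 1
    refine Finset.sum_congr rfl fun l hl => ?_
    rw [hxy (.ur l) (by simp [casLinks]), hxy (.rd l) (by simp [casLinks])]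
  · intro x y hxy
    simp only
    rw [hxy .ud (by simp)]

/-- The combined gain agrees almost surely with a function of the cascaded and direct coefficients,
and the interference uses only the remaining links. -/
lemma indepFun_gA2G_inr : IndepFun C.gA2G C.inr P := by
  classical
  have hd := measurable_dirGain (S := S)
  have h1 : (fun ω => (√(C.gCas ω) + √(dirGain S (C.h .ud ω))) ^ 2) =ᵐ[P] C.gA2G := by
    filter_upwards [C.gDirN_ae_eq] with ω hω
    rw [gA2G, sq_abs, hω]
  refine IndepFun.congr (g := C.inr) ?_ h1 (Filter.EventuallyEq.refl _ _)
  refine indepFun_of_dependsOn C.indep_h C.measurable_h (S := insert .ud (casLinks N L K))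
    (T := intLinks N L K) ?_
    (F := fun x => (√((∑ n, ‖x (.ur n)‖ * ‖x (.rd n)‖) ^ 2) + √(dirGain S (x .ud))) ^ 2)
    (G := fun x => (∑ l, S.inrI l * ‖x (.aerial l)‖ ^ 2) + ∑ k, S.inrJ k * ‖x (.ground k)‖ ^ 2)
    (by fun_prop) (by fun_prop) ?_ ?_
  · rw [Finset.disjoint_left]
    intro e he
    simp only [casLinks, Finset.mem_insert, Finset.mem_union, Finset.mem_image, Finset.mem_univ,
      true_and] at he
    rcases he with rfl | ⟨n, rfl⟩ | ⟨n, rfl⟩ <;> simp [intLinks]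
  · intro x y hxy
    simp only
    rw [hxy .ud (by simp), Finset.sum_congr rfl fun l _ => by
      rw [hxy (.ur l) (by simp [casLinks]), hxy (.rd l) (by simp [casLinks])]]
  · intro x y hxy
    simp only
    congr 1
    · exact Finset.sum_congr rfl fun l _ => by rw [hxy (.aerial l) (by simp [intLinks])]
    · exact Finset.sum_congr rfl fun k _ => by rw [hxy (.ground k) (by simp [intLinks])]

/-- The k-th power is (√γ_cas + √γ)^(2k); the binomial theorem and independence of the two gains
factor each mean. -/
theorem integral_gA2G_pow [IsProbabilityMeasure P] (k : ℕ) :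
    Integrable (fun ω => C.gA2G ω ^ k) P ∧ ∫ ω, C.gA2G ω ^ k ∂P = S.momA2G k := by
  have e : ∀ ω, C.gA2G ω ^ k = ∑ i ∈ Finset.range (2 * k + 1), ((2 * k).choose i : ℝ) *
      (C.gCas ω ^ (((2 * k - i : ℕ) : ℝ) / 2) * C.gDirN ω ^ ((i : ℝ) / 2)) := by
    intro ω
    rw [gA2G, sq_abs, ← pow_mul, add_comm, add_pow]
    refine Finset.sum_congr rfl fun i _ => ?_
    rw [rpow_half_eq_sqrt_pow _ (C.gCas_nonneg ω), rpow_half_eq_sqrt_pow _ (C.gDirN_nonneg ω)]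
    ring
  have hind : ∀ a b : ℝ, IndepFun (fun ω => C.gCas ω ^ a) (fun ω => C.gDirN ω ^ b) P := fun a b =>
    C.indepFun_gCas_gDirN.comp (show Measurable fun x : ℝ => x ^ a by fun_prop)
      (show Measurable fun x : ℝ => x ^ b by fun_prop)
  have hint : ∀ i j : ℕ, Integrable (fun ω => C.gCas ω ^ ((i : ℝ) / 2) *
      C.gDirN ω ^ ((j : ℝ) / 2)) P := fun i j =>
    (hind _ _).integrable_mul (C.integral_gCas_rpow i).1 (C.integral_gDirN_rpow j).1
  simp_rw [e]
  refine ⟨integrable_finsetSum _ fun i _ => (hint _ _).const_mul _, ?_⟩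
  rw [integral_finsetSum _ fun i _ => (hint _ _).const_mul _, System.momA2G]
  refine Finset.sum_congr rfl fun i _ => ?_
  rw [integral_const_mul, (hind _ _).integral_fun_mul_eq_mul_integral
    (C.integral_gCas_rpow _).1.aestronglyMeasurable
    (C.integral_gDirN_rpow _).1.aestronglyMeasurable, (C.integral_gCas_rpow _).2,
    (C.integral_gDirN_rpow _).2, mul_assoc]

/-- The link of an interferer. -/
def intLink : Fin L ⊕ Fin K → Link N L K := Sum.elim .aerial .ground

lemma intLink_injective : Function.Injective (intLink : Fin L ⊕ Fin K → Link N L K) := by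
  rintro (a | a) (b | b) h <;> simp_all [intLink]

lemma inr_eq (ω : Ω) : C.inr ω = ∑ x, S.inrInt x * ‖C.h (intLink x) ω‖ ^ 2 := by
  rw [Fintype.sum_sum_type]
  rfl

theorem integral_exp_neg_inr {s : ℝ} (hs : 0 ≤ s) :
    ∫ ω, Real.exp (-s * (C.inr ω + 1)) ∂P = S.delta0 s := by
  have e : ∀ ω, Real.exp (-s * (C.inr ω + 1)) = Real.exp (-s) *
      ∏ x, Real.exp (-s * (S.inrInt x * ‖C.h (intLink x) ω‖ ^ 2)) := by
    intro ω
    rw [← Real.exp_sum, ← Real.exp_add, C.inr_eq, ← Finset.mul_sum]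
    congr 1
    ring
  simp_rw [e]
  rw [integral_const_mul, S.delta0_eq]
  congr 1
  rw [iIndepFun.integral_fun_prod_comp (X := fun x ω => C.h (intLink x) ω)
    (f := fun x z => Real.exp (-s * (S.inrInt x * ‖z‖ ^ 2)))
    (C.indep_h.precomp intLink_injective) (fun x => (C.measurable_h _).aemeasurable)
    (fun x => Continuous.aestronglyMeasurable (by fun_prop))]
  refine Finset.prod_congr rfl fun x _ => ?_
  have hrice : S.rice (intLink x) = S.riceInt x := by cases x <;> rfl
  have hm := C.measurable_h (intLink x)
  refine (integrable_and_integral_eq_of_lintegral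
    (Measurable.aestronglyMeasurable (by fun_prop)) (Filter.Eventually.of_forall fun ω =>
      (Real.exp_pos _).le) (riceLaplace_pos (div_nonneg (S.inrInt_nonneg x) (by
        linarith [S.riceInt_nonneg x])) hs).le ?_).2
  rw [C.lintegral_comp_h (intLink x)
    (f := fun z => ENNReal.ofReal (Real.exp (-s * (S.inrInt x * ‖z‖ ^ 2)))) (by fun_prop), hrice,
    lintegral_exp_neg_sq_norm_ricianFading (S.riceInt_nonneg x) (S.inrInt_nonneg x) hs
      (S.norm_los _)]

/-! ### The SINR -/

lemma sinr_eq (ω : Ω) : C.sinr ω = S.snrCas * C.gA2G ω / (C.inr ω + 1) := by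
  have hc := S.snrCas_pos
  rw [sinr, gA2G, sq_abs, sq_abs]
  congr 1
  have h1 : S.snrDir * C.gDir ω = S.snrCas * C.gDirN ω := by
    rw [gDirN]
    field_simp
  rw [h1, Real.sqrt_mul hc.le, Real.sqrt_mul hc.le, ← mul_add, mul_pow, Real.sq_sqrt hc.le]

/-- By independence the joint law of gain and interference is the product of the marginals, which is
what `sinrCDF` integrates against. -/
theorem measureReal_sinr_le [IsProbabilityMeasure P] (x : ℝ) :
    P.real {ω | C.sinr ω ≤ x} = C.sinrCDF (P.map C.gA2G) x := by
  have hE : MeasurableSet {q : ℝ × ℝ | S.snrCas * q.1 / (q.2 + 1) ≤ x} :=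
    measurableSet_le (by fun_prop) (by fun_prop)
  have h1 : P.real {ω | C.sinr ω ≤ x} =
      (P.map fun ω => (C.gA2G ω, C.inr ω)).real {q : ℝ × ℝ | S.snrCas * q.1 / (q.2 + 1) ≤ x} := by
    rw [map_measureReal_apply (C.measurable_gA2G.prodMk C.measurable_inr) hE]
    simp_rw [sinr_eq]
    rfl
  have h2 : (P.map C.gA2G).prod (P.map C.inr) =
      ((P.map C.gA2G).prod P).map (Prod.map id C.inr) := by
    have : IsProbabilityMeasure (P.map C.gA2G) :=
      Measure.isProbabilityMeasure_map C.measurable_gA2G.aemeasurable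
    rw [← Measure.map_prod_map _ _ measurable_id C.measurable_inr, Measure.map_id]
  rw [h1, C.indepFun_gA2G_inr.map_prod_eq_prod_map_map C.measurable_gA2G.aemeasurable
    C.measurable_inr.aemeasurable, h2, map_measureReal_apply
    (measurable_id.prodMap C.measurable_inr) hE]
  rfl

end Channels

/-! ### Uniqueness of the Laplace transform on the half-line -/

open BoundedContinuousFunction in
/-- The function `y ↦ e^{-y}` on the half-line. -/
noncomputable def expNegBCF : NNReal →ᵇ ℝ :=
  BoundedContinuousFunction.ofNormedAddCommGroup (fun y : NNReal => Real.exp (-(y : ℝ)))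
    (by fun_prop) 1 fun y => by
      rw [Real.norm_of_nonneg (Real.exp_pos _).le, Real.exp_le_one_iff]
      simp

lemma expNegBCF_apply (y : NNReal) : expNegBCF y = Real.exp (-(y : ℝ)) := rfl

-- Polynomials in e^(-y) form an algebra of bounded continuous functions that separates points,
-- hence determines finite measures. Its monomials are e^(-ny), so integer arguments of the Laplace
-- transform suffice.
open BoundedContinuousFunction in
theorem ext_of_integral_exp_neg_natCast_nnreal {μ ν : Measure NNReal} [IsFiniteMeasure μ]
    [IsFiniteMeasure ν]
    (h : ∀ n : ℕ, ∫ y, Real.exp (-(n : ℝ) * y) ∂μ = ∫ y, Real.exp (-(n : ℝ) * y) ∂ν) : μ = ν := by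
  let A : StarSubalgebra ℝ (NNReal →ᵇ ℝ) :=
    { (Polynomial.aeval (R := ℝ) expNegBCF).range with
      star_mem' := fun {f} hf => by
        have : star f = f := by ext y; simp
        rwa [this] }
  refine ext_of_forall_mem_subalgebra_integral_eq_of_pseudoEMetric_complete_countable (𝕜 := ℝ)
    (A := A) ?_ ?_
  · intro x y hxy
    refine ⟨expNegBCF, ⟨expNegBCF.toContinuousMapStarₐ ℝ, ⟨expNegBCF, ?_, rfl⟩, rfl⟩, ?_⟩
    · exact ⟨Polynomial.X, Polynomial.aeval_X _⟩
    · simpa [expNegBCF_apply] using hxy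
  · rintro g ⟨p, rfl⟩
    change ∫ y, (Polynomial.aeval expNegBCF p : NNReal →ᵇ ℝ) y ∂μ =
      ∫ y, (Polynomial.aeval expNegBCF p : NNReal →ᵇ ℝ) y ∂ν
    induction p using Polynomial.induction_on' with
    | add p q hp hq =>
      simp only [map_add, BoundedContinuousFunction.coe_add, Pi.add_apply]
      rw [integral_add (BoundedContinuousFunction.integrable _ _)
        (BoundedContinuousFunction.integrable _ _),
        integral_add (BoundedContinuousFunction.integrable _ _)
        (BoundedContinuousFunction.integrable _ _), hp, hq]
    | monomial n a =>
      have e : ∀ y : NNReal, (Polynomial.aeval expNegBCF (Polynomial.monomial n a) :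
          NNReal →ᵇ ℝ) y = a * Real.exp (-(n : ℝ) * y) := by
        intro y
        rw [Polynomial.aeval_monomial, BoundedContinuousFunction.mul_apply,
          BoundedContinuousFunction.pow_apply, expNegBCF_apply, ← Real.exp_nat_mul]
        simp [BoundedContinuousFunction.algebraMap_apply]
      simp_rw [e]
      rw [integral_const_mul, integral_const_mul, h n]

theorem ext_of_integral_exp_neg_natCast {μ ν : Measure ℝ} [IsFiniteMeasure μ] [IsFiniteMeasure ν]
    (hμ : ∀ᵐ y ∂μ, 0 ≤ y) (hν : ∀ᵐ y ∂ν, 0 ≤ y)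
    (h : ∀ n : ℕ, ∫ y, Real.exp (-(n : ℝ) * y) ∂μ = ∫ y, Real.exp (-(n : ℝ) * y) ∂ν) : μ = ν := by
  have key : ∀ {μ : Measure ℝ}, (∀ᵐ y ∂μ, 0 ≤ y) →
      (μ.map Real.toNNReal).map ((↑) : NNReal → ℝ) = μ ∧ ∀ n : ℕ,
        ∫ y, Real.exp (-(n : ℝ) * y) ∂μ.map Real.toNNReal = ∫ y, Real.exp (-(n : ℝ) * y) ∂μ := by
    intro μ hμ
    constructor
    · rw [Measure.map_map (by fun_prop) (by fun_prop)]
      conv_rhs => rw [← Measure.map_id (μ := μ)]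
      refine Measure.map_congr ?_
      filter_upwards [hμ] with y hy
      simp [hy]
    · intro n
      rw [integral_map (by fun_prop) (Continuous.aestronglyMeasurable (by fun_prop))]
      refine integral_congr_ae ?_
      filter_upwards [hμ] with y hy
      simp [hy]
  have h1 : μ.map Real.toNNReal = ν.map Real.toNNReal :=
    ext_of_integral_exp_neg_natCast_nnreal fun n => by rw [(key hμ).2, (key hν).2, h n]
  rw [← (key hμ).1, ← (key hν).1, h1]

/-! ### The SISR law is a finite mixture of Gamma laws -/

lemma ae_gammaMeasure_pos (a r : ℝ) : ∀ᵐ y ∂gammaMeasure a r, 0 < y := by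
  have hm : MeasurableSet {y : ℝ | ¬ 0 < y} := measurableSet_Ioi.compl
  rw [ae_iff, ← lintegral_indicator_one hm,
    lintegral_gammaMeasure a r (measurable_one.indicator hm),
    setLIntegral_congr_fun (g := fun _ => 0) measurableSet_Ioi, lintegral_zero]
  intro y hy
  simp [Set.mem_Ioi.1 hy]

lemma measurable_nakagami_map (ψ Om : ℝ) : Measurable fun g : ℝ => √(Om * g / ψ) := by fun_prop

lemma isProbabilityMeasure_nakagami {ψ : ℝ} (hψ : 0 < ψ) (Om : ℝ) :
    IsProbabilityMeasure (nakagami ψ Om) :=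
  have := isProbabilityMeasure_gammaMeasure hψ one_pos
  Measure.isProbabilityMeasure_map (measurable_nakagami_map ψ Om).aemeasurable

lemma measurable_shadowedRician_map (u : ℂ) :
    Measurable fun q : ℂ × ℝ => ‖q.1 + (q.2 : ℂ) * u‖ ^ 2 := by fun_prop

lemma isProbabilityMeasure_shadowedRician {ψ : ℝ} (hψ : 0 < ψ) (Om s2 : ℝ) (u : ℂ) :
    IsProbabilityMeasure (shadowedRician ψ Om s2 u) :=
  have := isProbabilityMeasure_nakagami hψ Om
  Measure.isProbabilityMeasure_map (measurable_shadowedRician_map u).aemeasurable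

lemma isProbabilityMeasure_sisr {ψ : ℝ} (hψ : 0 < ψ) (I : ℕ) (Om s2 : ℝ) (u : Fin I → ℂ) :
    IsProbabilityMeasure (sisr I ψ Om s2 u) :=
  have := fun i => isProbabilityMeasure_shadowedRician hψ Om s2 (u i)
  Measure.isProbabilityMeasure_map (by fun_prop)

/-- Given the Nakagami amplitude, the transform is `riceLaplace`, which is exponential in the
squared amplitude. That square is a scaled Gamma variable, so a second Laplace transform finishes.
-/
theorem integral_exp_neg_shadowedRician {ψ Om s2 t : ℝ} (hψ : 0 < ψ) (hOm : 0 ≤ Om) (hs2 : 0 < s2)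
    {u : ℂ} (hu : ‖u‖ = 1) (ht : 0 ≤ t) :
    ∫ y, Real.exp (-t * y) ∂shadowedRician ψ Om s2 u =
      (1 + s2 * t)⁻¹ * ((1 + s2 * t) / (1 + (s2 + Om / ψ) * t)) ^ ψ := by
  have := isProbabilityMeasure_gammaMeasure hψ one_pos
  have := isProbabilityMeasure_nakagami hψ Om
  have h1 : 0 < 1 + s2 * t := by positivity
  have h2 : 0 < 1 + (s2 + Om / ψ) * t := by positivity
  refine (integrable_and_integral_eq_of_lintegral (Continuous.aestronglyMeasurable (by fun_prop))
    (Filter.Eventually.of_forall fun y => (Real.exp_pos _).le) (by positivity) ?_).2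
  rw [shadowedRician, lintegral_map (by fun_prop) (measurable_shadowedRician_map u),
    lintegral_prod_symm _ (by fun_prop)]
  simp only
  simp_rw [lintegral_exp_neg_sq_norm_add_complexGaussian hs2 ht]
  have hq : 0 ≤ Om / ψ * t / (1 + s2 * t) := by positivity
  rw [nakagami, lintegral_map (by unfold System.riceLaplace; fun_prop) (measurable_nakagami_map ψ Om)]
  have e : ∫⁻ g, ENNReal.ofReal (System.riceLaplace (‖((√(Om * g / ψ) : ℝ) : ℂ) * u‖ ^ 2 / s2) s2 t)
      ∂gammaMeasure ψ 1 = ∫⁻ g, ENNReal.ofReal (1 + s2 * t)⁻¹ * ENNReal.ofReal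
        (Real.exp (-(Om / ψ * t / (1 + s2 * t)) * g)) ∂gammaMeasure ψ 1 := by
    refine lintegral_congr_ae ?_
    filter_upwards [ae_gammaMeasure_pos ψ 1] with g hg
    rw [norm_sqrt_mul hu, Real.sq_sqrt (by positivity), ← ENNReal.ofReal_mul (by positivity),
      System.riceLaplace, div_eq_inv_mul]
    congr 3
    field_simp
    ring
  rw [e, lintegral_const_mul _ (by fun_prop), lintegral_exp_neg_mul_gammaMeasure hψ one_pos hq,
    ← ENNReal.ofReal_mul (by positivity)]
  congr 3
  field_simp
  ring

theorem integral_exp_neg_sisr {I m : ℕ} {ψ Om s2 t : ℝ} (hψ : 0 < ψ) (hm : (m : ℝ) = I * ψ)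
    (hOm : 0 ≤ Om) (hs2 : 0 < s2) {u : Fin I → ℂ} (hu : ∀ i, ‖u i‖ = 1) (ht : 0 ≤ t) :
    ∫ y, Real.exp (-t * y) ∂sisr I ψ Om s2 u =
      (1 + s2 * t)⁻¹ ^ I * ((1 + s2 * t) / (1 + (s2 + Om / ψ) * t)) ^ m := by
  have := fun i => isProbabilityMeasure_shadowedRician hψ Om s2 (u i)
  rw [sisr, integral_map (by fun_prop) (Continuous.aestronglyMeasurable (by fun_prop))]
  simp_rw [Finset.mul_sum, Real.exp_sum]
  rw [integral_fintype_prod_eq_prod (fun (i : Fin I) (y : ℝ) => Real.exp (-t * y))]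
  simp_rw [fun i => integral_exp_neg_shadowedRician hψ hOm hs2 (hu i) ht]
  rw [Finset.prod_const, Finset.card_univ, Fintype.card_fin, mul_pow]
  congr 1
  have h2 : 0 ≤ (1 + s2 * t) / (1 + (s2 + Om / ψ) * t) := by positivity
  rw [← Real.rpow_natCast, ← Real.rpow_mul h2, ← Real.rpow_natCast, hm, mul_comm ψ]

/-- The binomial weights of the Gamma laws in the SISR law. -/
noncomputable def mixWeight (M : ℕ) (ξ : ℝ) (k : ℕ) : ℝ :=
  (M.choose k : ℝ) * (1 / (ξ + 1) ^ k) * (ξ / (ξ + 1)) ^ (M - k)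

lemma mixWeight_nonneg {ξ : ℝ} (hξ : 0 ≤ ξ) (M k : ℕ) : 0 ≤ mixWeight M ξ k := by
  unfold mixWeight
  positivity

lemma sum_mixWeight_mul_pow {ξ : ℝ} (M : ℕ) (x : ℝ) :
    ∑ k ∈ Finset.range (M + 1), mixWeight M ξ k * x ^ k =
      (1 / (ξ + 1) * x + ξ / (ξ + 1)) ^ M := by
  rw [add_pow]
  refine Finset.sum_congr rfl fun k _ => ?_
  rw [mixWeight, mul_pow, one_div_pow]
  ring

/-- A finite mixture of Gamma laws with integer shapes `m - k` and scale `α`. -/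
noncomputable def erlangMixture (m M : ℕ) (ξ α : ℝ) : Measure ℝ :=
  ∑ k ∈ Finset.range (M + 1),
    ENNReal.ofReal (mixWeight M ξ k) • gammaMeasure ((m - k : ℕ) : ℝ) (1 / α)

lemma isProbabilityMeasure_erlang {m M k : ℕ} {α : ℝ} (hM : M < m) (hα : 0 < α)
    (hk : k ∈ Finset.range (M + 1)) :
    IsProbabilityMeasure (gammaMeasure ((m - k : ℕ) : ℝ) (1 / α)) := by
  rw [Finset.mem_range] at hk
  exact isProbabilityMeasure_gammaMeasure (Nat.cast_pos.2 (by omega)) (by positivity)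

lemma integral_erlangMixture {m M : ℕ} {ξ α : ℝ} (hξ : 0 ≤ ξ) {f : ℝ → ℝ}
    (hf : ∀ k ∈ Finset.range (M + 1), Integrable f (gammaMeasure ((m - k : ℕ) : ℝ) (1 / α))) :
    Integrable f (erlangMixture m M ξ α) ∧ ∫ y, f y ∂erlangMixture m M ξ α =
      ∑ k ∈ Finset.range (M + 1), mixWeight M ξ k *
        ∫ y, f y ∂gammaMeasure ((m - k : ℕ) : ℝ) (1 / α) := by
  have h : ∀ k ∈ Finset.range (M + 1), Integrable f
      (ENNReal.ofReal (mixWeight M ξ k) • gammaMeasure ((m - k : ℕ) : ℝ) (1 / α)) :=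
    fun k hk => (hf k hk).smul_measure ENNReal.ofReal_ne_top
  refine ⟨integrable_finsetSum_measure.2 h, ?_⟩
  rw [erlangMixture, integral_finsetSum_measure h]
  refine Finset.sum_congr rfl fun k _ => ?_
  rw [integral_smul_measure, ENNReal.toReal_ofReal (mixWeight_nonneg hξ M k), smul_eq_mul]

lemma integral_exp_neg_gammaMeasure {a r s : ℝ} (ha : 0 < a) (hr : 0 < r) (hs : 0 ≤ s) :
    Integrable (fun x => Real.exp (-s * x)) (gammaMeasure a r) ∧
      ∫ x, Real.exp (-s * x) ∂gammaMeasure a r = (r / (r + s)) ^ a :=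
  integrable_and_integral_eq_of_lintegral (Continuous.aestronglyMeasurable (by fun_prop))
    (Filter.Eventually.of_forall fun y => (Real.exp_pos _).le) (by positivity)
    (lintegral_exp_neg_mul_gammaMeasure ha hr hs)

lemma natCast_lt_of_eq_mul {I m : ℕ} {ψ : ℝ} (hI : 1 ≤ I) (hψ : 1 < ψ)
    (hm : (m : ℝ) = I * ψ) : I < m := by
  have : (1 : ℝ) ≤ I := by exact_mod_cast hI
  have : (I : ℝ) < m := by rw [hm]; nlinarith
  exact_mod_cast this

/-- Both transforms are compared. With ξ = Ω/(σ²ψ) and α = σ²(1 + ξ), the numerator base 1 + σ²t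
equals (1 + αt)/(ξ + 1) + ξ/(ξ + 1). Its power m - I expands binomially, and the k-th term cancels k
of the m factors 1 + αt in the denominator, leaving shape m - k. -/
theorem sisr_eq_erlangMixture {I m : ℕ} {ψ Om s2 : ℝ} (hI : 1 ≤ I) (hψ : 1 < ψ)
    (hm : (m : ℝ) = I * ψ) (hOm : 0 ≤ Om) (hs2 : 0 < s2) {u : Fin I → ℂ} (hu : ∀ i, ‖u i‖ = 1) :
    sisr I ψ Om s2 u = erlangMixture m (m - I) (Om / (s2 * ψ)) (s2 + Om / ψ) := by
  have hψ0 : 0 < ψ := by linarith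
  have hIm := natCast_lt_of_eq_mul hI hψ hm
  have hξ : 0 ≤ Om / (s2 * ψ) := by positivity
  have hα : 0 < s2 + Om / ψ := by positivity
  have hpos : ∀ k ∈ Finset.range (m - I + 1), (0 : ℝ) < ((m - k : ℕ) : ℝ) := fun k hk => by
    rw [Finset.mem_range] at hk
    exact Nat.cast_pos.2 (by omega)
  have hp : ∀ k ∈ Finset.range (m - I + 1),
      IsProbabilityMeasure (gammaMeasure ((m - k : ℕ) : ℝ) (1 / (s2 + Om / ψ))) := fun k hk =>
    isProbabilityMeasure_erlang (by omega) hα hk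
  have := isProbabilityMeasure_sisr hψ0 I Om s2 u
  have hfin : IsFiniteMeasure (erlangMixture m (m - I) (Om / (s2 * ψ)) (s2 + Om / ψ)) := by
    refine ⟨?_⟩
    rw [erlangMixture, Measure.finsetSum_apply]
    refine ENNReal.sum_lt_top.2 fun k hk => ?_
    have := hp k hk
    rw [Measure.smul_apply, measure_univ, smul_eq_mul, mul_one]
    exact ENNReal.ofReal_lt_top
  refine ext_of_integral_exp_neg_natCast ?_ ?_ fun n => ?_
  · rw [sisr, ae_map_iff (by fun_prop) (measurableSet_le (by fun_prop) (by fun_prop))]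
    have hsr : ∀ i, ∀ᵐ y ∂shadowedRician ψ Om s2 (u i), 0 ≤ y := by
      intro i
      rw [shadowedRician, ae_map_iff (measurable_shadowedRician_map _).aemeasurable
        (measurableSet_le (by fun_prop) (by fun_prop))]
      exact Filter.Eventually.of_forall fun q => sq_nonneg _
    have := fun i => isProbabilityMeasure_shadowedRician hψ0 Om s2 (u i)
    have h2 : ∀ᵐ x ∂(Measure.pi fun i => shadowedRician ψ Om s2 (u i)), ∀ i, 0 ≤ x i :=
      (ae_all_iff).2 fun i =>
        (Measure.quasiMeasurePreserving_eval (fun i => shadowedRician ψ Om s2 (u i)) i).ae (hsr i)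
    filter_upwards [h2] with x hx
    exact Finset.sum_nonneg fun i _ => hx i
  · rw [erlangMixture, ae_finsetSum_measure_iff]
    intro k hk
    refine Measure.ae_smul_measure ?_ _
    filter_upwards [ae_gammaMeasure_pos ((m - k : ℕ) : ℝ) (1 / (s2 + Om / ψ))] with y hy
    exact hy.le
  · have hn : (0 : ℝ) ≤ n := n.cast_nonneg
    have h1 : 0 < 1 + s2 * n := by positivity
    have h2 : 0 < 1 + (s2 + Om / ψ) * n := by positivity
    rw [integral_exp_neg_sisr hψ0 hm hOm hs2 hu hn, (integral_erlangMixture hξ fun k hk =>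
      (integral_exp_neg_gammaMeasure (hpos k hk) (by positivity) hn).1).2]
    have e : ∀ k ∈ Finset.range (m - I + 1), mixWeight (m - I) (Om / (s2 * ψ)) k *
        ∫ y, Real.exp (-(n : ℝ) * y) ∂gammaMeasure ((m - k : ℕ) : ℝ) (1 / (s2 + Om / ψ)) =
        (1 + (s2 + Om / ψ) * n)⁻¹ ^ m *
          (mixWeight (m - I) (Om / (s2 * ψ)) k * (1 + (s2 + Om / ψ) * n) ^ k) := by
      intro k hk
      rw [(integral_exp_neg_gammaMeasure (hpos k hk) (by positivity) hn).2, Real.rpow_natCast,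
        show 1 / (s2 + Om / ψ) / (1 / (s2 + Om / ψ) + n) = (1 + (s2 + Om / ψ) * n)⁻¹ by
          field_simp]
      have hk' : m - k + k = m := by
        rw [Finset.mem_range] at hk
        omega
      conv_rhs => rw [← hk', pow_add, hk']
      rw [inv_pow _ k]
      field_simp
    rw [Finset.sum_congr rfl e, ← Finset.mul_sum, sum_mixWeight_mul_pow,
      show 1 / (Om / (s2 * ψ) + 1) * (1 + (s2 + Om / ψ) * n) +
        Om / (s2 * ψ) / (Om / (s2 * ψ) + 1) = 1 + s2 * n by field_simp; ring, div_pow,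
      div_eq_mul_inv, inv_pow, inv_pow, mul_comm (_ ^ m) (_ : ℝ)⁻¹, mul_left_comm]
    congr 1
    rw [← Nat.sub_add_cancel hIm.le, pow_add, Nat.sub_add_cancel hIm.le, mul_comm, mul_assoc,
      mul_inv_cancel₀ (by positivity), mul_one]

/-! ### Tails of Erlang laws -/

/-- The tail function of the Erlang law with shape `k` and rate one. -/
noncomputable def erlangTail (k : ℕ) (x : ℝ) : ℝ :=
  ∑ n ∈ Finset.range k, Real.exp (-x) * x ^ n / n !

/-- The derivative telescopes: each new term cancels the previous remainder, so only minus the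
Erlang density survives. -/
lemma hasDerivAt_erlangTail (k : ℕ) (x : ℝ) :
    HasDerivAt (erlangTail (k + 1)) (-(Real.exp (-x) * x ^ k / k !)) x := by
  have he : HasDerivAt (fun x : ℝ => Real.exp (-x)) (-Real.exp (-x)) x := by
    simpa using (hasDerivAt_neg x).exp
  induction k with
  | zero =>
    have : erlangTail (0 + 1) = fun x => Real.exp (-x) := by ext x; simp [erlangTail]
    rw [this]
    simpa using he
  | succ k ih =>
    have : erlangTail (k + 1 + 1) = fun x => erlangTail (k + 1) x +
        Real.exp (-x) * x ^ (k + 1) / (k + 1)! := by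
      ext x
      rw [erlangTail, Finset.sum_range_succ]
      rfl
    rw [this]
    refine (ih.add ((he.mul (hasDerivAt_pow (k + 1) x)).div_const _)).congr_deriv ?_
    rw [Nat.factorial_succ, Nat.add_sub_cancel]
    have : (k ! : ℝ) ≠ 0 := by positivity
    push_cast
    field_simp
    ring

lemma tendsto_erlangTail (k : ℕ) :
    Filter.Tendsto (erlangTail k) Filter.atTop (nhds 0) := by
  have h : ∀ n ∈ Finset.range k, Filter.Tendsto (fun x : ℝ => Real.exp (-x) * x ^ n / n !)
      Filter.atTop (nhds 0) := fun n _ => by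
    have := (Real.tendsto_pow_mul_exp_neg_atTop_nhds_zero n).div_const (n ! : ℝ)
    rw [zero_div] at this
    exact this.congr fun x => by ring
  have h2 := tendsto_finsetSum _ h
  rw [Finset.sum_const_zero] at h2
  exact h2

/-- The mass of the tail is the integral of minus the derivative of `erlangTail`, which vanishes at
infinity. -/
theorem gammaMeasure_real_Iic {k : ℕ} (hk : 0 < k) {α c : ℝ} (hα : 0 < α) (hc : 0 ≤ c) :
    (gammaMeasure k (1 / α)).real (Set.Iic c) = 1 - erlangTail k (c / α) := by
  obtain ⟨j, rfl⟩ : ∃ j, k = j + 1 := ⟨k - 1, by omega⟩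
  have := isProbabilityMeasure_gammaMeasure (Nat.cast_pos.2 hk : (0 : ℝ) < ((j + 1 : ℕ) : ℝ))
    (show 0 < 1 / α by positivity)
  set g' : ℝ → ℝ := fun y => -(Real.exp (-(y / α)) * (y / α) ^ j / j !) * α⁻¹ with hg'
  have hd : ∀ y ∈ Set.Ici c, HasDerivAt (fun y => erlangTail (j + 1) (y / α)) (g' y) y := by
    intro y _
    have h := (hasDerivAt_erlangTail j (y / α)).comp y ((hasDerivAt_id y).div_const α)
    exact h.congr_deriv (by rw [hg', one_div])
  have hneg : ∀ y ∈ Set.Ioi c, g' y ≤ 0 := by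
    intro y hy
    have : 0 ≤ y := hc.trans (le_of_lt hy)
    rw [hg']
    simp only [neg_mul, neg_nonpos]
    positivity
  have ht : Filter.Tendsto (fun y => erlangTail (j + 1) (y / α)) Filter.atTop (nhds 0) :=
    (tendsto_erlangTail (j + 1)).comp (Filter.tendsto_id.atTop_div_const hα)
  have h1 := integral_Ioi_of_hasDerivAt_of_nonpos' hd hneg ht
  have hint := integrableOn_Ioi_deriv_of_nonpos' hd hneg ht
  have h2 : (gammaMeasure ((j + 1 : ℕ) : ℝ) (1 / α)).real (Set.Ioi c) =
      erlangTail (j + 1) (c / α) := by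
    rw [measureReal_def, ← lintegral_indicator_one measurableSet_Ioi,
      lintegral_gammaMeasure _ _ (measurable_one.indicator measurableSet_Ioi)]
    have e : ∫⁻ x in Set.Ioi 0, ENNReal.ofReal ((1 / α) ^ ((j + 1 : ℕ) : ℝ) /
        Real.Gamma ((j + 1 : ℕ) : ℝ) * x ^ (((j + 1 : ℕ) : ℝ) - 1) * Real.exp (-(1 / α * x))) *
          (Set.Ioi c).indicator 1 x = ∫⁻ x in Set.Ioi c, ENNReal.ofReal (-g' x) := by
      rw [← lintegral_indicator measurableSet_Ioi, ← lintegral_indicator measurableSet_Ioi]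
      refine lintegral_congr fun x => ?_
      by_cases hx : x ∈ Set.Ioi c
      · have hx0 : 0 < x := hc.trans_lt hx
        rw [Set.indicator_of_mem (Set.mem_Ioi.2 hx0), Set.indicator_of_mem hx,
          Set.indicator_of_mem hx, Pi.one_apply, mul_one]
        congr 1
        rw [Real.rpow_natCast, Nat.cast_succ, Real.Gamma_nat_eq_factorial, add_sub_cancel_right,
          Real.rpow_natCast, hg', pow_succ, one_div_pow,
          show -(1 / α * x) = -(x / α) by ring]
        simp only [div_pow]
        field_simp
      · rw [Set.indicator_of_notMem hx, Set.indicator_apply]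
        split_ifs
        · rw [Set.indicator_of_notMem hx, mul_zero]
        · rfl
    rw [e, ← ofReal_integral_eq_lintegral_ofReal (f := fun x => -g' x) hint.neg, integral_neg, h1, zero_sub, neg_neg,
      ENNReal.toReal_ofReal]
    · unfold erlangTail
      positivity
    · refine (ae_restrict_iff' measurableSet_Ioi).2 (Filter.Eventually.of_forall fun y hy => ?_)
      exact neg_nonneg.2 (hneg y hy)
  rw [← h2, ← Set.compl_Iic, probReal_compl_eq_one_sub measurableSet_Iic, sub_sub_cancel]

lemma sum_mixWeight {ξ : ℝ} (hξ : 0 ≤ ξ) (M : ℕ) :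
    ∑ k ∈ Finset.range (M + 1), mixWeight M ξ k = 1 := by
  have h := sum_mixWeight_mul_pow (ξ := ξ) M 1
  simp only [one_pow, mul_one] at h
  rw [h, ← add_div, add_comm, div_self (by positivity), one_pow]

theorem erlangMixture_real_Iic {m M : ℕ} {ξ α c : ℝ} (hM : M < m) (hξ : 0 ≤ ξ) (hα : 0 < α)
    (hc : 0 ≤ c) :
    (erlangMixture m M ξ α).real (Set.Iic c) =
      1 - ∑ k ∈ Finset.range (M + 1), mixWeight M ξ k * erlangTail (m - k) (c / α) := by
  have h1 : (erlangMixture m M ξ α).real (Set.Iic c) = ∑ k ∈ Finset.range (M + 1),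
      mixWeight M ξ k * (gammaMeasure ((m - k : ℕ) : ℝ) (1 / α)).real (Set.Iic c) := by
    rw [measureReal_def, erlangMixture, Measure.finsetSum_apply, ENNReal.toReal_sum]
    · refine Finset.sum_congr rfl fun k _ => ?_
      rw [Measure.smul_apply, smul_eq_mul, ENNReal.toReal_mul,
        ENNReal.toReal_ofReal (mixWeight_nonneg hξ M k), measureReal_def]
    · intro k hk
      have := isProbabilityMeasure_erlang hM hα hk
      rw [Measure.smul_apply, smul_eq_mul]
      exact ENNReal.mul_ne_top ENNReal.ofReal_ne_top (measure_ne_top _ _)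
  conv_rhs => rw [← sum_mixWeight hξ M, ← Finset.sum_sub_distrib]
  rw [h1]
  refine Finset.sum_congr rfl fun k hk => ?_
  rw [Finset.mem_range] at hk
  rw [gammaMeasure_real_Iic (by omega) hα hc]
  ring

/-! ### Moments of the Erlang mixture -/

/-- The weights are Bernstein polynomials evaluated at 1/(ξ + 1), whose first two factorial moments
are known identities. -/
lemma sum_mul_mixWeight {ξ : ℝ} (hξ : 0 ≤ ξ) (M : ℕ) :
    ∑ k ∈ Finset.range (M + 1), (k : ℝ) * mixWeight M ξ k = M * (1 / (ξ + 1)) ∧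
      ∑ k ∈ Finset.range (M + 1), (k : ℝ) * (k - 1) * mixWeight M ξ k =
        M * (M - 1) * (1 / (ξ + 1)) ^ 2 := by
  have h1ξ : ξ + 1 ≠ 0 := by positivity
  have e : ∀ k, (bernsteinPolynomial ℝ M k).eval (1 / (ξ + 1)) = mixWeight M ξ k := by
    intro k
    rw [bernsteinPolynomial, mixWeight]
    simp only [Polynomial.eval_mul, Polynomial.eval_natCast, Polynomial.eval_pow,
      Polynomial.eval_X, Polynomial.eval_sub, Polynomial.eval_one]
    rw [one_div_pow, show 1 - 1 / (ξ + 1) = ξ / (ξ + 1) by field_simp; ring]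
  have hc : ∀ k : ℕ, ((k * (k - 1) : ℕ) : ℝ) = k * (k - 1) := by
    intro k
    cases k <;> simp
  constructor
  · have h := congrArg (Polynomial.eval (1 / (ξ + 1))) (bernsteinPolynomial.sum_smul ℝ M)
    simp only [Polynomial.eval_finsetSum, nsmul_eq_mul, Polynomial.eval_mul,
      Polynomial.eval_natCast, e, Polynomial.eval_X] at h
    exact h
  · have h := congrArg (Polynomial.eval (1 / (ξ + 1))) (bernsteinPolynomial.sum_mul_smul ℝ M)
    simp only [Polynomial.eval_finsetSum, nsmul_eq_mul, Polynomial.eval_mul,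
      Polynomial.eval_natCast, e, Polynomial.eval_pow, Polynomial.eval_X, hc] at h
    exact h

lemma integral_pow_gammaMeasure {a r : ℝ} (ha : 0 < a) (hr : 0 < r) (k : ℕ) :
    Integrable (fun x => x ^ k) (gammaMeasure a r) ∧
      ∫ x, x ^ k ∂gammaMeasure a r = Real.Gamma (a + k) / (Real.Gamma a * r ^ k) := by
  have hG := Real.Gamma_pos_of_pos ha
  have hG' := Real.Gamma_pos_of_pos (show 0 < a + k by positivity)
  refine integrable_and_integral_eq_of_lintegral (Continuous.aestronglyMeasurable (by fun_prop))
    ?_ (by positivity) ?_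
  · filter_upwards [ae_gammaMeasure_pos a r] with x hx
    simp only [Pi.zero_apply]
    positivity
  · have h := lintegral_rpow_gammaMeasure ha hr (Nat.cast_nonneg (α := ℝ) k)
    simpa only [Real.rpow_natCast] using h

theorem integral_id_erlangMixture {m M : ℕ} {ξ α : ℝ} (hM : M < m) (hξ : 0 ≤ ξ) (hα : 0 < α) :
    Integrable (fun y => y) (erlangMixture m M ξ α) ∧
      ∫ y, y ∂erlangMixture m M ξ α = α * (m - M * (1 / (ξ + 1))) := by
  have hpos : ∀ k ∈ Finset.range (M + 1), (0 : ℝ) < ((m - k : ℕ) : ℝ) := fun k hk => by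
    rw [Finset.mem_range] at hk
    exact Nat.cast_pos.2 (by omega)
  have h1 : ∀ k ∈ Finset.range (M + 1),
      Integrable (fun y => y) (gammaMeasure ((m - k : ℕ) : ℝ) (1 / α)) := fun k hk => by
    simpa using (integral_pow_gammaMeasure (hpos k hk) (show 0 < 1 / α by positivity) 1).1
  refine ⟨(integral_erlangMixture hξ h1).1, ?_⟩
  rw [(integral_erlangMixture hξ h1).2]
  have e : ∀ k ∈ Finset.range (M + 1), mixWeight M ξ k *
      ∫ y, y ∂gammaMeasure ((m - k : ℕ) : ℝ) (1 / α) =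
        α * (m * mixWeight M ξ k - k * mixWeight M ξ k) := by
    intro k hk
    have h2 := (integral_pow_gammaMeasure (hpos k hk) (show 0 < 1 / α by positivity) 1).2
    have hG := Real.Gamma_pos_of_pos (hpos k hk)
    simp only [pow_one, Nat.cast_one] at h2
    rw [h2, Real.Gamma_add_one (hpos k hk).ne']
    rw [Finset.mem_range] at hk
    rw [Nat.cast_sub (show k ≤ m by omega)] at hG ⊢
    field_simp
  rw [Finset.sum_congr rfl e, ← Finset.mul_sum, Finset.sum_sub_distrib, ← Finset.mul_sum,
    sum_mixWeight hξ, (sum_mul_mixWeight hξ M).1, mul_one]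

theorem integral_sq_erlangMixture {m M : ℕ} {ξ α : ℝ} (hM : M < m) (hξ : 0 ≤ ξ) (hα : 0 < α) :
    Integrable (fun y => y ^ 2) (erlangMixture m M ξ α) ∧
      ∫ y, y ^ 2 ∂erlangMixture m M ξ α = α ^ 2 * (m * (m + 1) - 2 * m * (M * (1 / (ξ + 1))) +
        M * (M - 1) * (1 / (ξ + 1)) ^ 2) := by
  have hpos : ∀ k ∈ Finset.range (M + 1), (0 : ℝ) < ((m - k : ℕ) : ℝ) := fun k hk => by
    rw [Finset.mem_range] at hk
    exact Nat.cast_pos.2 (by omega)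
  have h1 : ∀ k ∈ Finset.range (M + 1),
      Integrable (fun y => y ^ 2) (gammaMeasure ((m - k : ℕ) : ℝ) (1 / α)) := fun k hk =>
    (integral_pow_gammaMeasure (hpos k hk) (show 0 < 1 / α by positivity) 2).1
  refine ⟨(integral_erlangMixture hξ h1).1, ?_⟩
  rw [(integral_erlangMixture hξ h1).2]
  have e : ∀ k ∈ Finset.range (M + 1), mixWeight M ξ k *
      ∫ y, y ^ 2 ∂gammaMeasure ((m - k : ℕ) : ℝ) (1 / α) =
        α ^ 2 * (m * (m + 1) * mixWeight M ξ k - 2 * m * (k * mixWeight M ξ k) +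
          k * (k - 1) * mixWeight M ξ k) := by
    intro k hk
    have h2 := (integral_pow_gammaMeasure (hpos k hk) (show 0 < 1 / α by positivity) 2).2
    have hG := Real.Gamma_pos_of_pos (hpos k hk)
    have hk0 := hpos k hk
    rw [h2, show ((m - k : ℕ) : ℝ) + (2 : ℕ) = ((m - k : ℕ) : ℝ) + 1 + 1 by push_cast; ring,
      Real.Gamma_add_one (by positivity), Real.Gamma_add_one hk0.ne']
    rw [Finset.mem_range] at hk
    rw [Nat.cast_sub (show k ≤ m by omega)] at hG ⊢
    field_simp
    ring
  rw [Finset.sum_congr rfl e, ← Finset.mul_sum, Finset.sum_add_distrib, Finset.sum_sub_distrib,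
    ← Finset.mul_sum, ← Finset.mul_sum, sum_mixWeight hξ, (sum_mul_mixWeight hξ M).1,
    (sum_mul_mixWeight hξ M).2, mul_one]

namespace Channels

variable {N L K : ℕ} {S : System N L K} {Ω : Type*} [MeasurableSpace Ω] {P : Measure Ω}
  (C : Channels S P)

/-! ### Exponentially tilted moments of the interference -/

/-- Differentiate the moment generating function n times at -s. As W = `C.inr` + 1 is nonnegative,
every s > 0 puts -s in the interior of the domain, and the substitution t ↦ -t produces the sign. -/
theorem integral_pow_mul_exp_neg_inr [IsProbabilityMeasure P] {s : ℝ} (hs : 0 < s) (n : ℕ) :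
    Integrable (fun ω => (C.inr ω + 1) ^ n * Real.exp (-s * (C.inr ω + 1))) P ∧
      ∫ ω, (C.inr ω + 1) ^ n * Real.exp (-s * (C.inr ω + 1)) ∂P = (-1) ^ n * S.delta n s := by
  have hm := C.measurable_inr
  set W : Ω → ℝ := fun ω => C.inr ω + 1 with hW
  have hsub : Set.Iic (0 : ℝ) ⊆ integrableExpSet W P := by
    intro t ht
    refine Integrable.mono' (integrable_const (1 : ℝ))
      (Measurable.aestronglyMeasurable (by fun_prop)) (Filter.Eventually.of_forall fun ω => ?_)
    rw [Real.norm_of_nonneg (Real.exp_pos _).le, Real.exp_le_one_iff]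
    exact mul_nonpos_of_nonpos_of_nonneg ht (by have := C.inr_nonneg ω; simp only [hW]; linarith)
  have hint : -s ∈ interior (integrableExpSet W P) := by
    refine interior_mono hsub ?_
    rw [interior_Iic]
    exact neg_neg_of_pos hs
  refine ⟨integrable_pow_mul_exp_of_mem_interior_integrableExpSet hint n, ?_⟩
  rw [← iteratedDeriv_mgf hint n]
  -- The closed form is known only on the negative half-line, but equality near -s is enough for
  -- derivatives there.
  have he : mgf W P =ᶠ[nhds (-s)] fun t => S.delta0 (-t) := by
    filter_upwards [Iio_mem_nhds (show -s < 0 by linarith)] with t ht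
    have ht : t < 0 := ht
    rw [← C.integral_exp_neg_inr (show 0 ≤ -t by linarith), neg_neg]
    rfl
  rw [he.iteratedDeriv_eq, iteratedDeriv_comp_neg, neg_neg, S.iteratedDeriv_delta0 n hs.le,
    smul_eq_mul]

/-! ### The SINR distribution for an Erlang mixture -/

/-- Condition on the interference: the event says that the mixture variable is at most xW/γ̄_cas.
Its Erlang tails are polynomials in W times e^(-sW), so the average involves only tilted moments of
W. -/
theorem sinrCDF_erlangMixture [IsProbabilityMeasure P] {m M : ℕ} {ξ α x : ℝ} (hM : M < m)
    (hξ : 0 ≤ ξ) (hα : 0 < α) [IsProbabilityMeasure (erlangMixture m M ξ α)] (hx : 0 < x) :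
    C.sinrCDF (erlangMixture m M ξ α) x = 1 - ∑ k ∈ Finset.range (M + 1), mixWeight M ξ k *
      ∑ n ∈ Finset.range (m - k), (-(x / (α * S.snrCas))) ^ n *
        S.delta n (x / (α * S.snrCas)) / (n ! : ℝ) := by
  have hc := S.snrCas_pos
  have hm := C.measurable_inr
  set s : ℝ := x / (α * S.snrCas) with hs
  have hs0 : 0 < s := by positivity
  have hE : MeasurableSet {q : ℝ × Ω | S.snrCas * q.1 / (C.inr q.2 + 1) ≤ x} :=
    measurableSet_le (by fun_prop) (by fun_prop)
  have hsec : ∀ ω, (fun y : ℝ => (y, ω)) ⁻¹' {q : ℝ × Ω | S.snrCas * q.1 / (C.inr q.2 + 1) ≤ x} =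
      Set.Iic (x * (C.inr ω + 1) / S.snrCas) := by
    intro ω
    have hW : 0 < C.inr ω + 1 := by linarith [C.inr_nonneg ω]
    ext y
    simp only [Set.mem_preimage, Set.mem_ofPred_eq, Set.mem_Iic]
    rw [div_le_iff₀ hW, le_div_iff₀ hc, mul_comm y]
  have h1 : C.sinrCDF (erlangMixture m M ξ α) x =
      ∫ ω, (erlangMixture m M ξ α).real (Set.Iic (x * (C.inr ω + 1) / S.snrCas)) ∂P := by
    rw [sinrCDF, measureReal_def, Measure.prod_apply_symm hE, ← integral_toReal]
    · simp_rw [hsec]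
      rfl
    · exact (measurable_measure_prodMk_right hE).aemeasurable
    · exact Filter.Eventually.of_forall fun ω => measure_lt_top _ _
  have h2 : ∀ ω, (erlangMixture m M ξ α).real (Set.Iic (x * (C.inr ω + 1) / S.snrCas)) =
      1 - ∑ k ∈ Finset.range (M + 1), mixWeight M ξ k * ∑ n ∈ Finset.range (m - k),
        s ^ n / (n ! : ℝ) * ((C.inr ω + 1) ^ n * Real.exp (-s * (C.inr ω + 1))) := by
    intro ω
    have hW : 0 < C.inr ω + 1 := by linarith [C.inr_nonneg ω]
    rw [erlangMixture_real_Iic hM hξ hα (by positivity),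
      show x * (C.inr ω + 1) / S.snrCas / α = s * (C.inr ω + 1) by rw [hs]; field_simp]
    congr 1
    refine Finset.sum_congr rfl fun k _ => ?_
    congr 1
    refine Finset.sum_congr rfl fun n _ => ?_
    rw [mul_pow, neg_mul]
    ring
  have hint := fun n : ℕ => (C.integral_pow_mul_exp_neg_inr hs0 n).1.const_mul (s ^ n / (n ! : ℝ))
  have hint2 : ∀ k : ℕ, Integrable (fun ω => mixWeight M ξ k * ∑ n ∈ Finset.range (m - k),
        s ^ n / (n ! : ℝ) * ((C.inr ω + 1) ^ n * Real.exp (-s * (C.inr ω + 1)))) P := fun k =>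
    (integrable_finsetSum _ fun n _ => hint n).const_mul _
  rw [h1]
  simp_rw [h2]
  rw [integral_sub (integrable_const _) (integrable_finsetSum _ fun k _ => hint2 k),
    integral_finsetSum _ fun k _ => hint2 k]
  simp only [integral_const, probReal_univ, one_smul]
  congr 1
  refine Finset.sum_congr rfl fun k _ => ?_
  rw [integral_const_mul, integral_finsetSum _ fun n _ => hint n]
  congr 1
  refine Finset.sum_congr rfl fun n _ => ?_
  rw [integral_const_mul, (C.integral_pow_mul_exp_neg_inr hs0 n).2, neg_pow s]
  ring

end Channels

/-! ### Parameters of the SISR law -/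

section Parameters

variable {I : ℕ} {ψ μ₁ μ₂ : ℝ}

lemma sisrOmega_nonneg : 0 ≤ sisrOmega I ψ μ₁ μ₂ := by
  unfold sisrOmega
  positivity

lemma sisrXi_eq (hs : 0 < sisrSigma2 I ψ μ₁ μ₂) :
    sisrXi I ψ μ₁ μ₂ = sisrOmega I ψ μ₁ μ₂ / (sisrSigma2 I ψ μ₁ μ₂ * ψ) := by
  rw [sisrXi, sisrKappa, ← div_div]
  congr 1
  field_simp
  ring

lemma sisrAlpha_eq (hs : 0 < sisrSigma2 I ψ μ₁ μ₂) (hψ : 0 < ψ) :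
    sisrAlpha I ψ μ₁ μ₂ = sisrSigma2 I ψ μ₁ μ₂ + sisrOmega I ψ μ₁ μ₂ / ψ := by
  rw [sisrAlpha, sisrXi_eq hs, sisrKappa]
  field_simp
  ring

lemma natCast_mul_sisrSigma2_add_sisrOmega (hI : 1 ≤ I) :
    (I : ℝ) * (sisrSigma2 I ψ μ₁ μ₂ + sisrOmega I ψ μ₁ μ₂) = μ₁ := by
  have : (I : ℝ) ≠ 0 := by positivity
  rw [sisrSigma2]
  field_simp
  ring

/-- The bound on I is precisely nonnegativity of the radicand in Ω, so squaring removes the root. -/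
lemma sq_sisrOmega (hI : 1 ≤ I) (hψ : 1 < ψ)
    (h : (I : ℝ) ≤ μ₁ ^ 2 / (μ₂ - μ₁ ^ 2)) :
    (I : ℝ) ^ 2 * sisrOmega I ψ μ₁ μ₂ ^ 2 * (ψ - 1) = ψ * (μ₁ ^ 2 * (I + 1) - I * μ₂) := by
  have hI' : (1 : ℝ) ≤ I := by exact_mod_cast hI
  -- A quotient of at least 1 with nonnegative numerator forces a positive denominator; the
  -- convention x/0 = 0 covers the degenerate case.
  have hD : 0 < μ₂ - μ₁ ^ 2 := by
    by_contra hD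
    have := div_nonpos_of_nonneg_of_nonpos (sq_nonneg μ₁) (not_lt.1 hD)
    linarith
  rw [le_div_iff₀ hD] at h
  have hψ1 : 0 < ψ - 1 := by linarith
  rw [sisrOmega, mul_pow, div_pow, div_pow, Real.sq_sqrt (by linarith), Real.sq_sqrt hψ1.le,
    Real.sq_sqrt (by nlinarith)]
  field_simp

end Parameters

/-! ### Matching of the first two moments -/

section MomentMatching

variable {I m : ℕ} {ψ μ₁ μ₂ : ℝ}

theorem integral_id_sisr (hI : 1 ≤ I) (hψ : 1 < ψ) (hm : (m : ℝ) = I * ψ)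
    (hs : 0 < sisrSigma2 I ψ μ₁ μ₂) {u : Fin I → ℂ} (hu : ∀ i, ‖u i‖ = 1) :
    Integrable (fun y => y) (sisr I ψ (sisrOmega I ψ μ₁ μ₂) (sisrSigma2 I ψ μ₁ μ₂) u) ∧
      ∫ y, y ∂sisr I ψ (sisrOmega I ψ μ₁ μ₂) (sisrSigma2 I ψ μ₁ μ₂) u = μ₁ := by
  have hψ0 : 0 < ψ := by linarith
  have hIm := natCast_lt_of_eq_mul hI hψ hm
  have hOm := sisrOmega_nonneg (I := I) (ψ := ψ) (μ₁ := μ₁) (μ₂ := μ₂)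
  have h1 := natCast_mul_sisrSigma2_add_sisrOmega (ψ := ψ) (μ₁ := μ₁) (μ₂ := μ₂) hI
  rw [sisr_eq_erlangMixture hI hψ hm hOm hs hu]
  set Om := sisrOmega I ψ μ₁ μ₂
  set s2 := sisrSigma2 I ψ μ₁ μ₂
  have h := integral_id_erlangMixture (m := m) (M := m - I) (ξ := Om / (s2 * ψ)) (α := s2 + Om / ψ)
    (by omega) (by positivity) (by positivity)
  refine ⟨h.1, ?_⟩
  rw [h.2, Nat.cast_sub hIm.le, hm]
  conv_rhs => rw [← h1]
  field_simp
  ring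

theorem integral_sq_sisr (hI : 1 ≤ I) (hψ : 1 < ψ) (hm : (m : ℝ) = I * ψ)
    (hs : 0 < sisrSigma2 I ψ μ₁ μ₂) (hμ : (I : ℝ) ≤ μ₁ ^ 2 / (μ₂ - μ₁ ^ 2)) {u : Fin I → ℂ}
    (hu : ∀ i, ‖u i‖ = 1) :
    Integrable (fun y => y ^ 2) (sisr I ψ (sisrOmega I ψ μ₁ μ₂) (sisrSigma2 I ψ μ₁ μ₂) u) ∧
      ∫ y, y ^ 2 ∂sisr I ψ (sisrOmega I ψ μ₁ μ₂) (sisrSigma2 I ψ μ₁ μ₂) u = μ₂ := by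
  have hψ0 : 0 < ψ := by linarith
  have hIm := natCast_lt_of_eq_mul hI hψ hm
  have hOm := sisrOmega_nonneg (I := I) (ψ := ψ) (μ₁ := μ₁) (μ₂ := μ₂)
  have h1 := natCast_mul_sisrSigma2_add_sisrOmega (ψ := ψ) (μ₁ := μ₁) (μ₂ := μ₂) hI
  have h2 := sq_sisrOmega hI hψ hμ
  rw [sisr_eq_erlangMixture hI hψ hm hOm hs hu]
  set Om := sisrOmega I ψ μ₁ μ₂
  set s2 := sisrSigma2 I ψ μ₁ μ₂
  have h := integral_sq_erlangMixture (m := m) (M := m - I) (ξ := Om / (s2 * ψ)) (α := s2 + Om / ψ)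
    (by omega) (by positivity) (by positivity)
  refine ⟨h.1, ?_⟩
  have hI0 : (I : ℝ) ≠ 0 := by positivity
  have hα : (1 / (Om / (s2 * ψ) + 1)) = s2 / (s2 + Om / ψ) := by
    field_simp
    ring
  -- The mixture formula in terms of σ² and Ω: squared mean plus I times the variance (σ² + Ω)² -
  -- Ω²(ψ - 1)/ψ of one summand. Inserting the equation for Ω² then gives μ₂.
  have e : (s2 + Om / ψ) ^ 2 * (m * (m + 1) - 2 * m * (((m - I : ℕ) : ℝ) *
      (1 / (Om / (s2 * ψ) + 1))) + ((m - I : ℕ) : ℝ) * (((m - I : ℕ) : ℝ) - 1) *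
        (1 / (Om / (s2 * ψ) + 1)) ^ 2) =
      (I * (s2 + Om)) ^ 2 + I * (s2 + Om) ^ 2 - I * Om ^ 2 * (ψ - 1) / ψ := by
    have hne : s2 + Om / ψ ≠ 0 := by positivity
    rw [hα, Nat.cast_sub hIm.le, hm]
    field_simp
    ring
  rw [h.2, e]
  have e2 : (I : ℝ) * Om ^ 2 * (ψ - 1) / ψ = (μ₁ ^ 2 * (I + 1) - I * μ₂) / I := by
    rw [div_eq_div_iff hψ0.ne' hI0]
    linear_combination h2
  have e3 : (I : ℝ) * (s2 + Om) ^ 2 = μ₁ ^ 2 / I := by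
    rw [← h1]
    field_simp
  rw [h1, e2, e3]
  field_simp
  ring

end MomentMatching

theorem Channels.sinrCDF_sisr {N L K : ℕ} {S : System N L K} {Ω : Type*} [MeasurableSpace Ω]
    {P : Measure Ω} [IsProbabilityMeasure P] (C : Channels S P) {I m : ℕ} {ψ μ₁ μ₂ x : ℝ}
    (hI : 1 ≤ I) (hψ : 1 < ψ) (hm : (m : ℝ) = I * ψ) (hs : 0 < sisrSigma2 I ψ μ₁ μ₂)
    {u : Fin I → ℂ} (hu : ∀ i, ‖u i‖ = 1) (hx : 0 < x) :
    C.sinrCDF (sisr I ψ (sisrOmega I ψ μ₁ μ₂) (sisrSigma2 I ψ μ₁ μ₂) u) x =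
      1 - ∑ k ∈ Finset.range (m - I + 1), sisrChi I m ψ μ₁ μ₂ k *
        ∑ n ∈ Finset.range (m - k), (-(x / (sisrAlpha I ψ μ₁ μ₂ * S.snrCas))) ^ n *
          S.delta n (x / (sisrAlpha I ψ μ₁ μ₂ * S.snrCas)) / (n ! : ℝ) := by
  have hψ0 : 0 < ψ := by linarith
  have hIm := natCast_lt_of_eq_mul hI hψ hm
  have hOm := sisrOmega_nonneg (I := I) (ψ := ψ) (μ₁ := μ₁) (μ₂ := μ₂)
  have hp := isProbabilityMeasure_sisr hψ0 I (sisrOmega I ψ μ₁ μ₂) (sisrSigma2 I ψ μ₁ μ₂) u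
  rw [sisr_eq_erlangMixture hI hψ hm hOm hs hu, ← sisrXi_eq hs, ← sisrAlpha_eq hs hψ0] at hp ⊢
  refine C.sinrCDF_erlangMixture (by omega) ?_ ?_ hx
  · rw [sisrXi_eq hs]
    positivity
  · rw [sisrAlpha_eq hs hψ0]
    positivity

end A2G

theorem theorem2 {Ω : Type*} [MeasurableSpace Ω] (P : Measure Ω) [IsProbabilityMeasure P]
    {N L K : ℕ} (S : A2G.System N L K) (C : A2G.Channels S P) :
    -- moments of the cascaded, direct and combined gains
    (∀ j : ℕ, Integrable (fun ω => C.gCas ω ^ ((j : ℝ) / 2)) P ∧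
      ∫ ω, C.gCas ω ^ ((j : ℝ) / 2) ∂P = S.momCas j) ∧
    (∀ i : ℕ, Integrable (fun ω => C.gDirN ω ^ ((i : ℝ) / 2)) P ∧
      ∫ ω, C.gDirN ω ^ ((i : ℝ) / 2) ∂P = S.momDir i) ∧
    S.blockProb = 1 - A2G.nuttallQ 1 0 √(2 * S.riceUD) √(2 * S.lamUD * S.τ) ∧
    (∀ k : ℕ, Integrable (fun ω => C.gA2G ω ^ k) P ∧ ∫ ω, C.gA2G ω ^ k ∂P = S.momA2G k) ∧
    -- the interference: Laplace transform and its derivatives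
    (∀ s : ℝ, 0 ≤ s → ∫ ω, Real.exp (-s * (C.inr ω + 1)) ∂P = S.delta0 s) ∧
    (∀ (n : ℕ) (s : ℝ), 0 ≤ s → iteratedDeriv n S.delta0 s = S.delta n s) ∧
    -- the SINR has the distribution determined by the law of the normalized SNR
    (∀ x : ℝ, P.real {ω | C.sinr ω ≤ x} = C.sinrCDF (P.map C.gA2G) x) ∧
    -- closed form of that distribution for the SISR law with the same first two moments
    (∀ (I m : ℕ) (ψ : ℝ) (u : Fin I → ℂ), 1 ≤ I → 1 < ψ → (m : ℝ) = I * ψ →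
      (∀ i, ‖u i‖ = 1) →
      I ≤ ⌊S.momA2G 1 ^ 2 / (S.momA2G 2 - S.momA2G 1 ^ 2)⌋₊ →
      0 < A2G.sisrSigma2 I ψ (S.momA2G 1) (S.momA2G 2) →
      let ν : Measure ℝ := A2G.sisr I ψ (A2G.sisrOmega I ψ (S.momA2G 1) (S.momA2G 2))
        (A2G.sisrSigma2 I ψ (S.momA2G 1) (S.momA2G 2)) u
      let α : ℝ := A2G.sisrAlpha I ψ (S.momA2G 1) (S.momA2G 2)
      IsProbabilityMeasure ν ∧
      (Integrable (fun y => y) ν ∧ ∫ y, y ∂ν = ∫ ω, C.gA2G ω ∂P) ∧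
      (Integrable (fun y => y ^ 2) ν ∧ ∫ y, y ^ 2 ∂ν = ∫ ω, C.gA2G ω ^ 2 ∂P) ∧
      ∀ x : ℝ, 0 < x →
        C.sinrCDF ν x = 1 - ∑ k ∈ Finset.range (m - I + 1),
          A2G.sisrChi I m ψ (S.momA2G 1) (S.momA2G 2) k *
            ∑ n ∈ Finset.range (m - k),
              (-(x / (α * S.snrCas))) ^ n * S.delta n (x / (α * S.snrCas)) / (n ! : ℝ)) := by
  refine ⟨C.integral_gCas_rpow, C.integral_gDirN_rpow, S.blockProb_eq, C.integral_gA2G_pow,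
    fun s hs => C.integral_exp_neg_inr hs, fun n s hs => S.iteratedDeriv_delta0 n hs,
    C.measureReal_sinr_le, ?_⟩
  intro I m ψ u hI hψ hm hu hfloor hs ν α
  -- As I is nonzero, the bound by the natural floor is equivalent to the real inequality with no
  -- sign condition on the quotient.
  have hμ := (Nat.le_floor_iff' (by omega)).1 hfloor
  have h1 := A2G.integral_id_sisr hI hψ hm hs hu
  have h2 := A2G.integral_sq_sisr hI hψ hm hs hμ hu
  refine ⟨A2G.isProbabilityMeasure_sisr (by linarith) _ _ _ _, ⟨h1.1, ?_⟩, ⟨h2.1, ?_⟩,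
    fun x hx => C.sinrCDF_sisr hI hψ hm hs hu hx⟩
  · rw [h1.2, ← (C.integral_gA2G_pow 1).2]
    simp only [pow_one]
  · rw [h2.2, (C.integral_gA2G_pow 2).2]
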